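/- **Setting.** Let $n,m\ge 1$; functions on $\mathbb R^n$ are measurable and scalar valued (real or complex), $B=B(c,r)$ denotes a ball with $r>0$, and $\lambda B=B(c,\lambda r)$. A weight is a nonnegative locally integrable function that is positive a.e., and $\omega(E)=\int_E\omega$. $A_q$ ($1\le q<\infty$) are the Muckenhoupt classes and $A_\infty=\bigcup_{1\le q<\infty}A_q$. For $1<p_1,\dots,p_m<\infty$, $1/p=\sum_i 1/p_i$, write $\vec\omega\in A_{\vec P}$ if the $\omega_i$ are weights and, with $v_{\vec\omega}=\prod_i\omega_i^{p/p_i}$, $$\sup_B\Big(\frac1{|B|}\int_B v_{\vec\omega}\Big)^{1/p}\prod_{i=1}^m\Big(\frac1{|B|}\int_B\omega_i^{1-p_i'}\Big)^{1/p_i'}<\infty .$$ $BMO$ is the space of locally integrable $b$ with $\|b\|_{BMO}=\sup_B\frac1{|B|}\int_B|b-b_B|<\infty$. For $x_0\in\mathbb R^n$, $0<q<\infty$, a weight $\omega$ and a non-negative measurable function $\varphi$ on $\mathbb R^n\times(0,\infty)$ let $M^{q,\varphi}_{x_0}(\omega)$ be the space of $f$ with $$\|f\|_{M^{q,\varphi}_{x_0}(\omega)}=\sup_{r>0}\varphi(x_0,r)^{-1}\,\omega(B(x_0,r))^{-1/q}\,\Big(\int_{B(x_0,r)}|f|^q\omega\Big)^{1/q}<\infty$$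 (conventions $0^{-1}=\infty$, $\infty\cdot 0=0$). For spaces $X_i$ of functions put $X_i+b_iX_i=\{f+b_ig: f,g\in X_i\}$. Let $T$ assign to every $\vec h\in\prod_i(X_i+b_iX_i)$ a measurable, everywhere defined function, and let $T$ be $m$-sublinear: at every point, $|T(\vec h)|$ is subadditive and absolutely homogeneous in each entry. The iterated commutator, defined on $\prod_i X_i$, is $$T_{\prod\vec b}(\vec f)(x)=T\big((b_1(x)-b_1)f_1,\dots,(b_m(x)-b_m)f_m\big)(x).$$ *Local size condition $LS(\prod_i D_i)$, with constant $A$:* for every ball $B$, all $f_i\in D_i$ and every nonempty $S\subseteq\{1,\dots,m\}$, $$\|T(g_1,\dots,g_m)\|_{L^\infty(B)}\le A\sum_{j=1}^\infty\prod_{i=1}^m\frac1{|2^{j+1}B|}\int_{2^{j+1}B}|f_i|,\qquad g_i=\begin{cases}f_i\chi_{(2B)^c}& i\in S,\\ f_i\chi_{2B}& i\notin S.\end{cases}$$ *Local boundedness condition $LB(\prod_i X_i\to Y)$, with constant $A$, for an operator $U$ from $\prod_i X_i$ to the measurable functions:* $\|U(f_1\chi_{2B},\dots,f_m\chi_{2B})\|_Y\le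 A\prod_i\|f_i\|_{X_i}$ for every ball $B$ and all $f_i\in X_i$. **Theorem 1.4.** Let $1<p_i<\infty$ for $i=1,\dots,m$, $1/p=\sum_i1/p_i$, $\vec\omega\in A_{\vec P}\cap(A_\infty)^m$, $v\in A_\infty$, $x_0\in\mathbb R^n$, and let $\varphi_{11},\dots,\varphi_{1m},\varphi_2$ be non-negative measurable functions on $\mathbb R^n\times(0,\infty)$ with $$[\vec\varphi_1,\varphi_2]_2'=\sup_{r>0}\varphi_2(x_0,r)^{-1}\int_r^\infty\Big(1+\log\frac tr\Big)^m\frac{\operatorname*{ess\,inf}_{t<\eta<\infty}\prod_{i=1}^m\varphi_{1i}(x_0,\eta)\,\omega_i(B(x_0,\eta))^{1/p_i}}{\prod_{i=1}^m\omega_i(B(x_0,t))^{1/p_i}}\,\frac{dt}t<\infty .$$ Put $X_i=M^{p_i,\varphi_{1i}}_{x_0}(\omega_i)$ and $Y=M^{p,\varphi_2}_{x_0}(v)$. Let $\vec b\in BMO^m$ and let $T$ be $m$-sublinear on $\prod_i(X_i+b_iX_i)$. 1. If $T\in LS\big(\prod_i(X_i+b_iX_i)\big)$ and $T_{\prod\vec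 b}\in LB(\prod_iX_i\to Y)$, then $T_{\prod\vec b}$ is bounded from $\prod_iX_i$ to $Y$: there is $K<\infty$ with $T_{\prod\vec b}(\vec f)\in Y$ and $\|T_{\prod\vec b}(\vec f)\|_Y\le K\prod_i\|f_i\|_{X_i}$ for all $f_i\in X_i$. 2. Moreover, for all $A_1,A_2<\infty$ there is $K<\infty$, depending only on $A_1,A_2$ and on $n,m,p_i,\vec\omega,v,\vec\varphi_1,\varphi_2,x_0$ (but not on $T$ and $\vec b$), such that if $T$ satisfies $LS\big(\prod_i(X_i+b_iX_i)\big)$ with constant $A_1$ and $T_{\prod\vec b}$ satisfies $LB(\prod_i X_i\to Y)$ with constant $A_2\prod_j\|b_j\|_{BMO}$, i.e. $$\|T_{\prod\vec b}(f_1\chi_{2B},\dots,f_m\chi_{2B})\|_Y\le A_2\prod_{j}\|b_j\|_{BMO}\prod_i\|f_i\|_{X_i}\quad\text{for all balls }B,\ f_i\in X_i,$$ then $T_{\prod\vec b}$ maps $\prod_iX_i$ to $Y$ and $\|T_{\prod\vec b}\|_{\prod X_i\to Y}\le K\prod_j\|b_j\|_{BMO}$. -/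

import Mathlib

open MeasureTheory Set Metric
open scoped ENNReal NNReal

noncomputable section

/-- The Euclidean space `ℝⁿ`. -/
abbrev Rn (n : ℕ) : Type := EuclideanSpace ℝ (Fin n)

/-! ### Weights -/

/-- A weight: a nonnegative locally integrable function with values in `(0, ∞)` a.e. -/
structure IsWeight {n : ℕ} (w : Rn n → ℝ) : Prop where
  nonneg : ∀ x, 0 ≤ w x
  locallyIntegrable : LocallyIntegrable w volume
  ae_pos : ∀ᵐ x ∂(volume : Measure (Rn n)), 0 < w x

/-- The measure `w dx`; thus `wMeasure w E = w(E) = ∫_E w`. -/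
def wMeasure {n : ℕ} (w : Rn n → ℝ) : Measure (Rn n) :=
  volume.withDensity (fun x => ENNReal.ofReal (w x))

/-- The mean value `|B|⁻¹ ∫_B g` over the ball `B = B(c, r)` of a `[0, ∞]`-valued function. -/
def ballMean {n : ℕ} (c : Rn n) (r : ℝ) (g : Rn n → ℝ≥0∞) : ℝ≥0∞ :=
  (volume (ball c r))⁻¹ * ∫⁻ x in ball c r, g x

/-- The Muckenhoupt class `A_p`, `1 ≤ p < ∞`. -/
def IsMuckenhoupt {n : ℕ} (p : ℝ) (w : Rn n → ℝ) : Prop :=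
  IsWeight w ∧ ∃ C : ℝ≥0, ∀ (c : Rn n) (r : ℝ), 0 < r →
    if p = 1 then
      ballMean c r (fun x => ENNReal.ofReal (w x)) ≤
        C * essInf (fun x => ENNReal.ofReal (w x)) (volume.restrict (ball c r))
    else
      ballMean c r (fun x => ENNReal.ofReal (w x)) *
        (ballMean c r (fun x => ENNReal.ofReal (w x) ^ (-(1 / (p - 1))))) ^ (p - 1) ≤ C

/-- The class `A_∞ = ⋃_{1 ≤ p < ∞} A_p`. -/
def IsAInfty {n : ℕ} (w : Rn n → ℝ) : Prop :=
  ∃ p : ℝ, 1 ≤ p ∧ IsMuckenhoupt p w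

/-- The multiple weight condition `A_P` for exponents `1 < p₁, …, p_m < ∞` and
`1/p = ∑ 1/p_i`, where `v_ω = ∏ ω_i^{p/p_i}`:
`sup_B (|B|⁻¹ ∫_B v_ω)^{1/p} ∏ (|B|⁻¹ ∫_B ω_i^{1 - p_i'})^{1/p_i'} < ∞`. -/
def IsMultiAP {n m : ℕ} (p : ℝ) (P : Fin m → ℝ) (w : Fin m → Rn n → ℝ) : Prop :=
  (∀ i, IsWeight (w i)) ∧ ∃ C : ℝ≥0, ∀ (c : Rn n) (r : ℝ), 0 < r →
    (ballMean c r (fun x => ENNReal.ofReal (∏ i, w i x ^ (p / P i)))) ^ (1 / p) *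
      ∏ i, (ballMean c r
        (fun x => ENNReal.ofReal (w i x) ^ (1 - (P i).conjExponent))) ^ (1 / (P i).conjExponent)
      ≤ C

/-! ### Function spaces -/

/-- The (quasi-)norm of the generalized local weighted Morrey space `M^{p,φ}_{x₀}(w)`:
`sup_{r>0} φ(x₀,r)⁻¹ w(B(x₀,r))^{-1/p} ‖f‖_{L^p(B(x₀,r), w dx)}`. -/
def morreyNorm {𝕜 : Type*} [RCLike 𝕜] {n : ℕ} (p : ℝ) (φ : Rn n → ℝ → ℝ≥0) (x₀ : Rn n)
    (w : Rn n → ℝ) (f : Rn n → 𝕜) : ℝ≥0∞ :=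
  ⨆ (r : ℝ) (_ : 0 < r),
    (φ x₀ r : ℝ≥0∞)⁻¹ * (wMeasure w (ball x₀ r)) ^ (-(1 / p)) *
      eLpNorm f (ENNReal.ofReal p) ((wMeasure w).restrict (ball x₀ r))

/-- The space of (Lebesgue) measurable functions at which the functional `N` is finite. -/
def normSpace {𝕜 : Type*} [RCLike 𝕜] {n : ℕ} (N : (Rn n → 𝕜) → ℝ≥0∞) : Set (Rn n → 𝕜) :=
  {f | AEStronglyMeasurable f volume ∧ N f < ∞}

/-- `‖b‖_BMO = sup_B |B|⁻¹ ∫_B |b - b_B|`. -/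
def bmoNorm {𝕜 : Type*} [RCLike 𝕜] {n : ℕ} (b : Rn n → 𝕜) : ℝ≥0∞ :=
  ⨆ (c : Rn n) (r : ℝ) (_ : 0 < r), ballMean c r (fun x => ‖b x - ⨍ y in ball c r, b y‖ₑ)

/-- `b ∈ BMO`. -/
def IsBMO {𝕜 : Type*} [RCLike 𝕜] {n : ℕ} (b : Rn n → 𝕜) : Prop :=
  LocallyIntegrable b volume ∧ bmoNorm b < ∞

/-! ### Operators -/

/-- `T` is an `m`-sublinear operator from `∏ D_i` to the measurable functions. -/
structure IsMSublinear {𝕜 : Type*} [RCLike 𝕜] {n m : ℕ}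
    (T : (Fin m → Rn n → 𝕜) → Rn n → 𝕜) (D : Fin m → Set (Rn n → 𝕜)) : Prop where
  measurable : ∀ f, (∀ i, f i ∈ D i) → AEStronglyMeasurable (T f) volume
  add_le : ∀ f, (∀ i, f i ∈ D i) → ∀ i, ∀ g ∈ D i, ∀ x,
    ‖T (Function.update f i (f i + g)) x‖ ≤ ‖T f x‖ + ‖T (Function.update f i g) x‖
  smul : ∀ f, (∀ i, f i ∈ D i) → ∀ i, ∀ a : 𝕜, ∀ x,
    ‖T (Function.update f i (a • f i)) x‖ = ‖a‖ * ‖T f x‖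

/-- The truncated tuple whose entry is `f_i χ_{(2B)ᶜ}` for `i ∈ S` and `f_i χ_{2B}` for `i ∉ S`,
where `B = B(c, r)`. -/
def truncTuple {𝕜 : Type*} [RCLike 𝕜] {n m : ℕ} (S : Finset (Fin m)) (c : Rn n) (r : ℝ)
    (f : Fin m → Rn n → 𝕜) : Fin m → Rn n → 𝕜 :=
  fun i => if i ∈ S then (ball c (2 * r))ᶜ.indicator (f i) else (ball c (2 * r)).indicator (f i)

/-- The local size condition `LS(∏ D_i)` with constant `A`: for every ball `B` and all `f_i ∈ D_i`,
as soon as at least one entry is cut off to `(2B)ᶜ` and the others to `2B`, the `L^∞(B)` norm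
is at most `A ∑_{j ≥ 1} ∏_i |2^{j+1}B|⁻¹ ∫_{2^{j+1}B} |f_i|`. -/
def LocalSize {𝕜 : Type*} [RCLike 𝕜] {n m : ℕ} (T : (Fin m → Rn n → 𝕜) → Rn n → 𝕜)
    (D : Fin m → Set (Rn n → 𝕜)) (A : ℝ≥0) : Prop :=
  ∀ (c : Rn n) (r : ℝ), 0 < r → ∀ f, (∀ i, f i ∈ D i) →
    ∀ S : Finset (Fin m), S.Nonempty →
      eLpNorm (T (truncTuple S c r f)) ∞ (volume.restrict (ball c r)) ≤
        A * ∑' j : ℕ, ∏ i, ballMean c (2 ^ (j + 2) * r) (fun y => ‖f i y‖ₑ)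

/-- The local boundedness condition `LB(∏ X_i → Y)` with constant `A`, for an operator `S` from
`∏ X_i` to the measurable functions, where `X_i`, `Y` have the (quasi-)norms `N_i`, `NY`:
`‖S(f₁χ_{2B}, …, f_mχ_{2B})‖_Y ≤ A ∏ ‖f_i‖_{X_i}` for every ball `B`. -/
def LocalBound {𝕜 : Type*} [RCLike 𝕜] {n m : ℕ} (S : (Fin m → Rn n → 𝕜) → Rn n → 𝕜)
    (N : Fin m → (Rn n → 𝕜) → ℝ≥0∞) (NY : (Rn n → 𝕜) → ℝ≥0∞) (A : ℝ≥0∞) : Prop :=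
  (∀ f, (∀ i, f i ∈ normSpace (N i)) → AEStronglyMeasurable (S f) volume) ∧
  ∀ (c : Rn n) (r : ℝ), 0 < r → ∀ f, (∀ i, f i ∈ normSpace (N i)) →
    NY (S (truncTuple ∅ c r f)) ≤ A * ∏ i, N i (f i)

/-- `S` is bounded from `∏ X_i` to `Y` with norm at most `K`. -/
def BoundedBy {𝕜 : Type*} [RCLike 𝕜] {n m : ℕ} (S : (Fin m → Rn n → 𝕜) → Rn n → 𝕜)
    (N : Fin m → (Rn n → 𝕜) → ℝ≥0∞) (NY : (Rn n → 𝕜) → ℝ≥0∞) (K : ℝ≥0∞) : Prop :=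
  ∀ f, (∀ i, f i ∈ normSpace (N i)) → S f ∈ normSpace NY ∧ NY (S f) ≤ K * ∏ i, N i (f i)

/-- The iterated commutator `T_{∏b}(f)(x) = T((b₁(x) - b₁)f₁, …, (b_m(x) - b_m)f_m)(x)`. -/
def iteratedCommutator {𝕜 : Type*} [RCLike 𝕜] {n m : ℕ} (T : (Fin m → Rn n → 𝕜) → Rn n → 𝕜)
    (b : Fin m → Rn n → 𝕜) : (Fin m → Rn n → 𝕜) → Rn n → 𝕜 :=
  fun f x => T (fun i y => (b i x - b i y) * f i y) x

/-- The linear space `X + bX = {f + b g : f, g ∈ X}`. It contains `f` and `(b(x) - b) f` for all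
`f ∈ X` and all `x`, so that a commutator with `b` is defined on `X`
for operators acting on `X + bX`. -/
def commDomain {𝕜 : Type*} [RCLike 𝕜] {n : ℕ} (b : Rn n → 𝕜) (X : Set (Rn n → 𝕜)) :
    Set (Rn n → 𝕜) :=
  {h | ∃ f ∈ X, ∃ g ∈ X, h = f + b * g}

/-- The quantity `[φ₁, φ₂]₂'` for the weights `w_i`, the exponents `p_i` and the point `x₀`. -/
def logCondition {n m : ℕ} (P : Fin m → ℝ) (w : Fin m → Rn n → ℝ)
    (φ₁ : Fin m → Rn n → ℝ → ℝ≥0) (φ₂ : Rn n → ℝ → ℝ≥0) (x₀ : Rn n) : ℝ≥0∞ :=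
  ⨆ (r : ℝ) (_ : 0 < r), (φ₂ x₀ r : ℝ≥0∞)⁻¹ *
    ∫⁻ t in Ioi r, ENNReal.ofReal ((1 + Real.log (t / r)) ^ m) *
      (essInf (fun η => ∏ i, (φ₁ i x₀ η : ℝ≥0∞) * (wMeasure (w i) (ball x₀ η)) ^ (1 / P i))
          (volume.restrict (Ioi t)) /
        ∏ i, (wMeasure (w i) (ball x₀ t)) ^ (1 / P i)) *
      ENNReal.ofReal (1 / t)

end

/-!
The commutator at a point `x` of `B = B(x₀, r)` is `T` applied to the functions
`(b_i(x) - b_i) f_i`. With `l_i` the mean of `b_i` over the cube around `B`, writing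
`b_i(x) - b_i = (b_i(x) - l_i) + (l_i - b_i)` and cutting at `2B`, sublinearity bounds it by the
commutator at `f_i χ_{2B}`, which the local boundedness condition controls, and by finitely many
products of `|b_i(x) - l_i|`, `i ∈ Q`, with values of `T` at tuples that no longer depend on `x`,
to which the local size condition applies
(`IsMSublinear.norm_iteratedCommutator_le`). Three estimates remain.

* Moments of BMO functions with respect to `v` and to the dual weights `σ_i = w_i ^ (1 - p_i')`.
  All these measures share the property `BallComparable`, which follows from Hölder's inequality
  alone (`IsAInfty.ballComparable`, `IsMultiAP.ballComparable_dualWeight`). It implies that a set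
  filling at most half of a cube has at most `γ < 1` times its mass. This suffices to iterate the
  Calderón–Zygmund decomposition of `|b - b_Q|` directly for the measure in question
  (`measure_cube_le_pow`); no reverse Hölder inequality is needed. On `2 ^ k B` the moments of
  `b - l` grow linearly in `k` (`BallComparable.exists_lintegral_ball_rpow_le`).
* The means over `2 ^ k B` in the local size condition. By Hölder's inequality they are bounded by
  the norms of `f_i` in `L ^ p_i (w_i)` and the masses of `σ_i`. The masses of the `σ_i` are bounded
  by those of the `w_i` through `A_P` and a reverse Jensen inequality for the `A_∞` weights `w_i`
  (`IsMultiAP.exists_prod_mul_prod_le`, `IsMultiAP.exists_prod_ballMean_commTuple_le`).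
* The sum over `k`. Since the `w_i` are doubling, the `k`-th term is at most a constant times the
  part over `(2 ^ k r, 2 ^ (k + 1) r]` of the integral in `logCondition`, where `(k + 1) ^ m` turns
  into the power of the logarithm and the norms of the `f_i` are bounded by their Morrey norms at
  every larger radius, hence by the essential infimum (`exists_tsum_le_logIntegral`).
-/

section Weights

variable {n m : ℕ}

/-! ### Muckenhoupt weights and dual weights -/

lemma volume_ball_pos (c : Rn n) {r : ℝ} (hr : 0 < r) : volume (ball c r) ≠ 0 :=
  (measure_ball_pos volume c hr).ne'

lemma volume_ball_ne_top (c : Rn n) (r : ℝ) : volume (ball c r) ≠ ∞ := measure_ball_lt_top.ne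

lemma ballMean_eq_lintegral (c : Rn n) (r : ℝ) (g : Rn n → ℝ≥0∞) :
    ballMean c r g = ∫⁻ x, g x ∂((volume (ball c r))⁻¹ • volume.restrict (ball c r)) := by
  rw [ballMean, lintegral_smul_measure, smul_eq_mul]

/-- Hölder's inequality for mean values over a ball. -/
lemma ballMean_prod_rpow_le {ι : Type*} [Fintype ι] {g : ι → Rn n → ℝ≥0∞}
    (hg : ∀ i, AEMeasurable (g i) volume) {θ : ι → ℝ} (h1 : ∑ i, θ i = 1) (h0 : ∀ i, 0 ≤ θ i)
    (c : Rn n) (r : ℝ) :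
    ballMean c r (fun x => ∏ i, g i x ^ θ i) ≤ ∏ i, ballMean c r (g i) ^ θ i := by
  simp only [ballMean_eq_lintegral]
  refine ENNReal.lintegral_prod_norm_pow_le Finset.univ (fun i _ => ?_) h1 (fun i _ => h0 i)
  exact ((hg i).restrict).smul_measure _

lemma ballMean_mono_ae {c : Rn n} {r : ℝ} {f g : Rn n → ℝ≥0∞} (h : ∀ᵐ x, f x ≤ g x) :
    ballMean c r f ≤ ballMean c r g :=
  mul_le_mul_right (lintegral_mono_ae (ae_restrict_of_ae h)) _

lemma ballMean_one (c : Rn n) {r : ℝ} (hr : 0 < r) : ballMean c r (fun _ => 1) = 1 := by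
  simp [ballMean, ENNReal.inv_mul_cancel (volume_ball_pos c hr) (volume_ball_ne_top c r)]

lemma ballMean_indicator {c : Rn n} {r : ℝ} {G : Set (Rn n)} (hG : MeasurableSet G)
    (hGB : G ⊆ ball c r) (g : Rn n → ℝ≥0∞) :
    ballMean c r (G.indicator g) = (volume (ball c r))⁻¹ * ∫⁻ x in G, g x := by
  rw [ballMean, setLIntegral_indicator hG, inter_eq_left.2 hGB]

lemma ballMean_ne_zero {c : Rn n} {r : ℝ} (hr : 0 < r) {g : Rn n → ℝ≥0∞}
    (hg : AEMeasurable g volume) (h : ∀ᵐ x, g x ≠ 0) : ballMean c r g ≠ 0 := by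
  refine mul_ne_zero (ENNReal.inv_ne_zero.2 (volume_ball_ne_top c r)) fun h0 => ?_
  rw [lintegral_eq_zero_iff' hg.restrict] at h0
  have : ∀ᵐ x ∂(volume.restrict (ball c r)), False := by
    filter_upwards [h0, ae_restrict_of_ae h] with x hx hx'
    exact hx' hx
  rw [Filter.eventually_false_iff_eq_bot, ae_eq_bot, Measure.restrict_eq_zero] at this
  exact volume_ball_pos c hr this

lemma IsWeight.aemeasurable {w : Rn n → ℝ} (h : IsWeight w) : AEMeasurable w volume :=
  h.locallyIntegrable.aestronglyMeasurable.aemeasurable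

lemma IsWeight.aemeasurable_ofReal {w : Rn n → ℝ} (h : IsWeight w) :
    AEMeasurable (fun x => ENNReal.ofReal (w x)) volume := h.aemeasurable.ennreal_ofReal

lemma IsWeight.ae_ofReal {w : Rn n → ℝ} (h : IsWeight w) :
    ∀ᵐ x, ENNReal.ofReal (w x) ≠ 0 := by
  filter_upwards [h.ae_pos] with x hx
  simpa using hx

lemma wMeasure_ball (w : Rn n → ℝ) (c : Rn n) (r : ℝ) :
    wMeasure w (ball c r) = ∫⁻ x in ball c r, ENNReal.ofReal (w x) :=
  withDensity_apply _ measurableSet_ball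

lemma IsWeight.wMeasure_ball_lt_top {w : Rn n → ℝ} (h : IsWeight w) (c : Rn n) (r : ℝ) :
    wMeasure w (ball c r) < ∞ := by
  rw [wMeasure_ball]
  have h1 : IntegrableOn w (closedBall c r) volume :=
    h.locallyIntegrable.integrableOn_isCompact (isCompact_closedBall c r)
  have h2 := (h1.mono_set ball_subset_closedBall).2
  rw [hasFiniteIntegral_iff_ofReal (Filter.Eventually.of_forall h.nonneg)] at h2
  exact h2

lemma IsWeight.ballMean_ne_zero {w : Rn n → ℝ} (h : IsWeight w) (c : Rn n) {r : ℝ} (hr : 0 < r) :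
    ballMean c r (fun x => ENNReal.ofReal (w x)) ≠ 0 :=
  _root_.ballMean_ne_zero hr h.aemeasurable_ofReal h.ae_ofReal

lemma IsWeight.ballMean_ne_top {w : Rn n → ℝ} (h : IsWeight w) (c : Rn n) {r : ℝ} (hr : 0 < r) :
    ballMean c r (fun x => ENNReal.ofReal (w x)) ≠ ∞ := by
  rw [ballMean, ← wMeasure_ball]
  exact ENNReal.mul_ne_top (ENNReal.inv_ne_top.2 (volume_ball_pos c hr))
    (h.wMeasure_ball_lt_top c r).ne

lemma IsWeight.wMeasure_ball_ne_zero {w : Rn n → ℝ} (h : IsWeight w) (c : Rn n) {r : ℝ}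
    (hr : 0 < r) : wMeasure w (ball c r) ≠ 0 := by
  rw [wMeasure_ball]
  exact right_ne_zero_of_mul (h.ballMean_ne_zero c hr)

lemma IsAInfty.isWeight {w : Rn n → ℝ} (h : IsAInfty w) : IsWeight w := by
  obtain ⟨p, -, h⟩ := h
  exact h.1

/-- All the classes `A_q` in one form, with `s = 1 / (q - 1)` for `q > 1` and `s = 1` for `q = 1`:
`A_1` is contained in `A_2`. -/
lemma IsAInfty.exists_ballMean_mul_le {w : Rn n → ℝ} (h : IsAInfty w) :
    ∃ s : ℝ, 0 < s ∧ ∃ C : ℝ≥0, ∀ (c : Rn n) (r : ℝ), 0 < r →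
      ballMean c r (fun x => ENNReal.ofReal (w x)) *
        (ballMean c r (fun x => ENNReal.ofReal (w x) ^ (-s))) ^ (1 / s) ≤ C := by
  have hw := h.isWeight
  obtain ⟨p, hp, -, C, hC⟩ := h
  rcases hp.eq_or_lt with rfl | hp
  · refine ⟨1, one_pos, C, fun c r hr => ?_⟩
    have h1 := hC c r hr
    rw [if_pos rfl] at h1
    set a := ballMean c r (fun x => ENNReal.ofReal (w x))
    have ha : a ≠ ∞ := hw.ballMean_ne_top c hr
    have h2 : ∀ᵐ x ∂(volume.restrict (ball c r)), a * ENNReal.ofReal (w x) ^ (-1 : ℝ) ≤ C := by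
      filter_upwards [ae_essInf_le (μ := volume.restrict (ball c r))
        (f := fun x => ENNReal.ofReal (w x))] with x hx
      rw [ENNReal.rpow_neg_one]
      exact ENNReal.div_le_of_le_mul (h1.trans (by gcongr))
    simp only [one_div, inv_one, ENNReal.rpow_one]
    rw [ballMean, mul_left_comm, ← lintegral_const_mul' _ _ ha]
    calc _ ≤ (volume (ball c r))⁻¹ * ∫⁻ x in ball c r, (C : ℝ≥0∞) := by
          exact mul_le_mul_right (lintegral_mono_ae h2) _
      _ = C * ((volume (ball c r))⁻¹ * volume (ball c r)) := by simp; ring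
      _ = C := by
        rw [ENNReal.inv_mul_cancel (volume_ball_pos c hr) (volume_ball_ne_top c r), mul_one]
  · refine ⟨1 / (p - 1), by simpa using hp, C, fun c r hr => ?_⟩
    have h1 := hC c r hr
    rw [if_neg hp.ne'] at h1
    simpa using h1

/-- A measure, absolutely continuous and finite on balls, for which the proportion of a ball
occupied by a set is controlled by a power of the proportion of mass. It stands for the property
`A_∞` of weights: it gives doubling, and it bounds the mass of small sets by `γ < 1` times the
mass of the ball. -/
structure BallComparable (ν : Measure (Rn n)) : Prop where
  ac : ν ≪ volume
  ball_lt_top : ∀ c r, ν (ball c r) < ∞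
  comparable : ∃ C : ℝ≥0, ∃ N : ℝ, 0 < N ∧ ∀ (c : Rn n) (r : ℝ), 0 < r → ∀ G ⊆ ball c r,
    MeasurableSet G → (volume G / volume (ball c r)) ^ N * ν (ball c r) ≤ C * ν G

/-- Means of `∏ g_i ^ θ_i` with `∏ g_i ^ θ_i = 1` a.e.: localizing one of the factors to `G`
leaves at least the proportion of `G` in the ball. -/
lemma volume_div_le_of_prod_eq_one {ι : Type*} [Fintype ι] [DecidableEq ι]
    {g : ι → Rn n → ℝ≥0∞}
    (hg : ∀ i, AEMeasurable (g i) volume) {θ : ι → ℝ} (h1 : ∑ i, θ i = 1) (h0 : ∀ i, 0 ≤ θ i)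
    (hprod : ∀ᵐ x, ∏ i, g i x ^ θ i = 1) (k : ι)
    {c : Rn n} {r : ℝ} {G : Set (Rn n)} (hG : MeasurableSet G) (hGB : G ⊆ ball c r) :
    volume G / volume (ball c r) ≤
      ((volume (ball c r))⁻¹ * ∫⁻ x in G, g k x) ^ θ k *
        ∏ i ∈ Finset.univ.erase k, ballMean c r (g i) ^ θ i := by
  have key := ballMean_prod_rpow_le (g := Function.update g k (G.indicator (g k))) (θ := θ)
    (fun i => by
      by_cases hi : i = k
      · subst hi; simpa using (hg i).indicator hG
      · simpa [Function.update_of_ne hi] using hg i) h1 h0 c r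
  rw [← Finset.mul_prod_erase _ _ (Finset.mem_univ k)] at key
  simp only [Function.update_self, ballMean_indicator hG hGB] at key
  rw [Finset.prod_congr rfl (fun i hi => by
    rw [Function.update_of_ne (Finset.ne_of_mem_erase hi)] :
      ∀ i ∈ Finset.univ.erase k, ballMean c r (Function.update g k (G.indicator (g k)) i) ^ θ i
        = ballMean c r (g i) ^ θ i)] at key
  refine le_trans ?_ key
  calc volume G / volume (ball c r) = ballMean c r (G.indicator (fun _ => 1)) := by
        rw [ballMean_indicator hG hGB]; simp [ENNReal.div_eq_inv_mul]
    _ ≤ _ := by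
      refine ballMean_mono_ae ?_
      filter_upwards [hprod] with x hx
      by_cases hxG : x ∈ G
      · rw [indicator_of_mem hxG, ← hx]
        refine Finset.prod_le_prod' fun i _ => ?_
        by_cases hi : i = k
        · subst hi; simp [hxG]
        · simp [Function.update_of_ne hi]
      · simp [hxG]

lemma ENNReal.rpow_mul_rpow_neg_eq_one {a : ℝ≥0∞} (h0 : a ≠ 0) (ht : a ≠ ∞) (e : ℝ) :
    a ^ e * a ^ (-e) = 1 := by
  rw [← ENNReal.rpow_add _ _ h0 ht, add_neg_cancel, ENNReal.rpow_zero]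

lemma IsAInfty.ballComparable {w : Rn n → ℝ} (h : IsAInfty w) : BallComparable (wMeasure w) := by
  have hw := h.isWeight
  refine ⟨withDensity_absolutelyContinuous _ _, hw.wMeasure_ball_lt_top, ?_⟩
  obtain ⟨s, hs, C, hC⟩ := h.exists_ballMean_mul_le
  refine ⟨C, (1 + s) / s, by positivity, fun c r hr G hGB hG => ?_⟩
  have h1s : (1 + s) ≠ 0 := by positivity
  have key := volume_div_le_of_prod_eq_one (ι := Bool) (n := n)
    (g := fun b x => bif b then ENNReal.ofReal (w x) else ENNReal.ofReal (w x) ^ (-s))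
    (θ := fun b => bif b then s / (1 + s) else 1 / (1 + s))
    (by rintro (_ | _)
        · exact hw.aemeasurable_ofReal.pow_const _
        · exact hw.aemeasurable_ofReal)
    (by simp; field_simp; ring) (by rintro (_ | _) <;> simp <;> positivity)
    (by
      filter_upwards [hw.ae_ofReal] with x hx
      simp only [Fintype.prod_bool, cond_true, cond_false]
      rw [← ENNReal.rpow_mul]
      convert ENNReal.rpow_mul_rpow_neg_eq_one hx ENNReal.ofReal_ne_top (s / (1 + s)) using 3
      ring) true hG hGB
  rw [show (Finset.univ.erase true : Finset Bool) = {false} from rfl, Finset.prod_singleton] at key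
  simp only [cond_true, cond_false] at key
  rw [← withDensity_apply _ hG] at key
  change _ ≤ (_ * wMeasure w G) ^ _ * _ at key
  have hV0 := volume_ball_pos c hr
  have hVt := volume_ball_ne_top c r
  set V := volume (ball c r)
  set S := ballMean c r (fun x => ENNReal.ofReal (w x) ^ (-s))
  have key2 : (volume G / V) ^ ((1 + s) / s) ≤ V⁻¹ * wMeasure w G * S ^ (1 / s) := by
    refine (ENNReal.rpow_le_rpow key (by positivity)).trans_eq ?_
    rw [ENNReal.mul_rpow_of_nonneg _ _ (by positivity), ← ENNReal.rpow_mul, ← ENNReal.rpow_mul,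
      show s / (1 + s) * ((1 + s) / s) = 1 by field_simp,
      show 1 / (1 + s) * ((1 + s) / s) = 1 / s by field_simp, ENNReal.rpow_one]
  calc _ ≤ V⁻¹ * wMeasure w G * S ^ (1 / s) * wMeasure w (ball c r) := by gcongr
    _ = (V⁻¹ * wMeasure w (ball c r)) * S ^ (1 / s) * wMeasure w G := by ring
    _ ≤ C * wMeasure w G := by
      gcongr
      rw [wMeasure_ball]
      exact hC c r hr

lemma conjExponent_pos {p : ℝ} (hp : 1 < p) : 0 < p.conjExponent :=
  (Real.HolderConjugate.conjExponent hp).symm.pos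

lemma one_sub_conjExponent {p : ℝ} (hp : 1 < p) :
    1 - p.conjExponent = -(p.conjExponent / p) := by
  have := Real.HolderConjugate.conjExponent hp
  have h1 := this.inv_add_inv_eq_one
  have h2 := this.pos.ne'
  have h3 := this.symm.pos.ne'
  field_simp at h1 ⊢
  linarith

/-- The dual weight `w ^ (1 - p')`, with the value `∞` on the null set where `w = 0`. -/
noncomputable def dualWeight (p : ℝ) (w : Rn n → ℝ) (x : Rn n) : ℝ≥0∞ :=
  ENNReal.ofReal (w x) ^ (1 - p.conjExponent)

lemma IsWeight.aemeasurable_dualWeight {w : Rn n → ℝ} (h : IsWeight w) (p : ℝ) :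
    AEMeasurable (dualWeight p w) volume := h.aemeasurable_ofReal.pow_const _

lemma IsWeight.dualWeight_ne_zero {w : Rn n → ℝ} (h : IsWeight w) {p : ℝ} :
    ∀ᵐ x, dualWeight p w x ≠ 0 := by
  filter_upwards [h.ae_ofReal] with x hx
  simp [dualWeight, ENNReal.rpow_eq_zero_iff, hx]

section MultiAP

variable {p : ℝ} {P : Fin m → ℝ} {w : Fin m → Rn n → ℝ}

lemma pos_of_one_div_eq_sum (hm : 0 < m) (hP : ∀ i, 1 < P i) (hp : 1 / p = ∑ i, 1 / P i) :
    0 < p := by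
  have : 0 < 1 / p := by
    rw [hp]
    have : Nonempty (Fin m) := ⟨⟨0, hm⟩⟩
    exact Finset.sum_pos (fun i _ => by have := hP i; positivity) Finset.univ_nonempty
  exact one_div_pos.1 this

/-- The product weight `∏ w_i ^ (p / p_i)`. -/
noncomputable def prodWeight (p : ℝ) (P : Fin m → ℝ) (w : Fin m → Rn n → ℝ) (x : Rn n) : ℝ≥0∞ :=
  ENNReal.ofReal (∏ i, w i x ^ (p / P i))

lemma aemeasurable_prodWeight (hw : ∀ i, IsWeight (w i)) :
    AEMeasurable (prodWeight p P w) volume := by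
  refine AEMeasurable.ennreal_ofReal ?_
  exact Finset.aemeasurable_fun_prod _ fun i _ => (hw i).aemeasurable.pow_const _

lemma prodWeight_eq (hw : ∀ i, IsWeight (w i)) :
    ∀ᵐ x, prodWeight p P w x = ∏ i, ENNReal.ofReal (w i x) ^ (p / P i) := by
  filter_upwards [ae_all_iff.2 fun i => (hw i).ae_pos] with x hx
  rw [prodWeight, ENNReal.ofReal_prod_of_nonneg (fun i _ => Real.rpow_nonneg (hx i).le _)]
  exact Finset.prod_congr rfl fun i _ => (ENNReal.ofReal_rpow_of_pos (hx i)).symm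

lemma prodWeight_ne_zero (hw : ∀ i, IsWeight (w i)) :
    ∀ᵐ x, prodWeight p P w x ≠ 0 := by
  filter_upwards [ae_all_iff.2 fun i => (hw i).ae_pos] with x hx
  simp only [prodWeight, ne_eq, ENNReal.ofReal_eq_zero, not_le]
  exact Finset.prod_pos fun i _ => Real.rpow_pos_of_pos (hx i) _

lemma IsMultiAP.ballMean_dualWeight_ne_top (h : IsMultiAP p P w) (hp0 : 0 < p)
    (hP : ∀ i, 1 < P i) (c : Rn n) {r : ℝ} (hr : 0 < r) (i : Fin m) : ballMean c r (dualWeight (P i) (w i)) ≠ ∞ := by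
  obtain ⟨hw, C, hC⟩ := h
  intro htop
  have h1 := hC c r hr
  rw [← Finset.mul_prod_erase _ _ (Finset.mem_univ i)] at h1
  change ballMean c r (prodWeight p P w) ^ (1 / p) *
    (ballMean c r (dualWeight (P i) (w i)) ^ (1 / (P i).conjExponent) *
    ∏ j ∈ Finset.univ.erase i, ballMean c r (dualWeight (P j) (w j)) ^ (1 / (P j).conjExponent))
      ≤ C at h1
  rw [htop, ENNReal.top_rpow_of_pos (one_div_pos.2 (conjExponent_pos (hP i))), ENNReal.top_mul,
    ENNReal.mul_top] at h1
  · exact absurd h1 (by simp)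
  · rw [ne_eq, ENNReal.rpow_eq_zero_iff_of_pos (one_div_pos.2 hp0)]
    exact ballMean_ne_zero hr (aemeasurable_prodWeight hw) (prodWeight_ne_zero hw)
  · refine Finset.prod_ne_zero_iff.2 fun j _ => ?_
    rw [ne_eq, ENNReal.rpow_eq_zero_iff_of_pos (one_div_pos.2 (conjExponent_pos (hP j)))]
    exact ballMean_ne_zero hr ((hw j).aemeasurable_dualWeight _) (hw j).dualWeight_ne_zero

lemma sum_holder_exponents (hP : ∀ i, 1 < P i) :
    ∑ i, (1 / P i + 1 / (P i).conjExponent) = m := by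
  rw [Finset.sum_congr rfl (fun i _ => by
    simpa using (Real.HolderConjugate.conjExponent (hP i)).inv_add_inv_eq_one :
      ∀ i ∈ Finset.univ, 1 / P i + 1 / (P i).conjExponent = 1)]
  simp

/-- The dual weights are in `A_∞`, in the form of `BallComparable`: apply Hölder's inequality to
`1 = v ^ (1 / p) * ∏ σ_i ^ (1 / p_i')`, with `σ_k` localized to a subset of the ball. -/
lemma IsMultiAP.ballComparable_dualWeight (h : IsMultiAP p P w) (hm : 0 < m)
    (hP : ∀ i, 1 < P i) (hp : 1 / p = ∑ i, 1 / P i) (k : Fin m) :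
    BallComparable ((volume : Measure (Rn n)).withDensity (dualWeight (P k) (w k))) := by
  have hp0 := pos_of_one_div_eq_sum hm hP hp
  have hfin := fun c r hr => h.ballMean_dualWeight_ne_top hp0 hP (n := n) c (r := r) hr
  obtain ⟨hw, C, hC⟩ := h
  have hm' : (0 : ℝ) < m := by exact_mod_cast hm
  have hq : ∀ i, 0 < (P i).conjExponent := fun i => conjExponent_pos (hP i)
  have hP0 : ∀ i, 0 < P i := fun i => one_pos.trans (hP i)
  have hball : ∀ c r, volume.withDensity (dualWeight (P k) (w k)) (ball c r) =
      ∫⁻ x in ball c r, dualWeight (P k) (w k) x := fun c r =>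
    withDensity_apply _ measurableSet_ball
  refine ⟨withDensity_absolutelyContinuous _ _, fun c r => ?_, C ^ (P k).conjExponent,
    m * (P k).conjExponent, by have := hq k; positivity, fun c r hr G hGB hG => ?_⟩
  · rcases le_or_gt r 0 with hr | hr
    · simp [ball_eq_empty.2 hr]
    · rw [hball, lt_top_iff_ne_top]
      intro htop
      refine hfin c r hr k ?_
      rw [ballMean, htop, ENNReal.mul_top (ENNReal.inv_ne_zero.2 (volume_ball_ne_top c r))]
  have key := volume_div_le_of_prod_eq_one (ι := Option (Fin m)) (n := n)
    (g := fun o => o.elim (prodWeight p P w) (fun i => dualWeight (P i) (w i)))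
    (θ := fun o => o.elim (1 / p / m) (fun i => 1 / (P i).conjExponent / m))
    (by rintro (_ | i)
        · exact aemeasurable_prodWeight hw
        · exact (hw i).aemeasurable_dualWeight _)
    (by
      have := sum_holder_exponents hP
      rw [Finset.sum_add_distrib] at this
      rw [Fintype.sum_option]
      simp only [Option.elim]
      rw [← Finset.sum_div, ← add_div, hp, this, div_self hm'.ne'])
    (by rintro (_ | i)
        · simp only [Option.elim]; positivity
        · have := hq i
          simp only [Option.elim]; positivity)
    (by
      filter_upwards [prodWeight_eq (p := p) (P := P) hw, ae_all_iff.2 fun i => (hw i).ae_ofReal]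
        with x hx hx0
      simp only [Fintype.prod_option, Option.elim]
      rw [hx, ← ENNReal.prod_rpow_of_nonneg (by positivity), ← Finset.prod_mul_distrib]
      refine Finset.prod_eq_one fun i _ => ?_
      rw [dualWeight, ← ENNReal.rpow_mul, ← ENNReal.rpow_mul, one_sub_conjExponent (hP i)]
      convert ENNReal.rpow_mul_rpow_neg_eq_one (hx0 i) ENNReal.ofReal_ne_top (1 / P i / m) using 3
      · field_simp
      · have := (hq i).ne'
        have := (hP0 i).ne'
        field_simp) (some k) hG hGB
  have hsplit : ∏ o ∈ (Finset.univ.erase (some k) : Finset (Option (Fin m))),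
      ballMean c r (o.elim (prodWeight p P w) (fun i => dualWeight (P i) (w i))) ^
        (o.elim (1 / p / m) (fun i => 1 / (P i).conjExponent / m)) =
      ballMean c r (prodWeight p P w) ^ (1 / p / m) * ∏ i ∈ Finset.univ.erase k,
        ballMean c r (dualWeight (P i) (w i)) ^ (1 / (P i).conjExponent / m) := by
    have : (Finset.univ.erase (some k) : Finset (Option (Fin m))) =
        Finset.insertNone (Finset.univ.erase k) := by
      ext o; cases o <;> simp
    rw [this, Finset.prod_insertNone]
    rfl
  rw [hsplit] at key
  simp only [Option.elim] at key
  rw [← withDensity_apply _ hG] at key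
  set σ := (volume : Measure (Rn n)).withDensity (dualWeight (P k) (w k))
  have hV0 := volume_ball_pos c hr
  have hVt := volume_ball_ne_top c r
  set V := volume (ball c r)
  have key2 : (volume G / V) ^ (m : ℝ) ≤ (V⁻¹ * σ G) ^ (1 / (P k).conjExponent) *
      (ballMean c r (prodWeight p P w) ^ (1 / p) * ∏ i ∈ Finset.univ.erase k,
        ballMean c r (dualWeight (P i) (w i)) ^ (1 / (P i).conjExponent)) := by
    refine (ENNReal.rpow_le_rpow key hm'.le).trans_eq ?_
    rw [ENNReal.mul_rpow_of_nonneg _ _ hm'.le, ENNReal.mul_rpow_of_nonneg _ _ hm'.le,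
      ← ENNReal.prod_rpow_of_nonneg hm'.le]
    simp only [← ENNReal.rpow_mul, div_mul_cancel₀ _ hm'.ne']
  have key3 : (volume G / V) ^ (m : ℝ) * (V⁻¹ * σ (ball c r)) ^ (1 / (P k).conjExponent) ≤
      (V⁻¹ * σ G) ^ (1 / (P k).conjExponent) * C := by
    calc _ ≤ _ := mul_le_mul_left key2 _
      _ = (V⁻¹ * σ G) ^ (1 / (P k).conjExponent) * (ballMean c r (prodWeight p P w) ^ (1 / p) *
        ((V⁻¹ * σ (ball c r)) ^ (1 / (P k).conjExponent) * ∏ i ∈ Finset.univ.erase k,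
        ballMean c r (dualWeight (P i) (w i)) ^ (1 / (P i).conjExponent))) := by ring
      _ ≤ _ := by
        refine mul_le_mul_right ?_ _
        have := hC c r hr
        rw [← Finset.mul_prod_erase _ _ (Finset.mem_univ k)] at this
        rw [hball]
        exact this
  have key4 := ENNReal.rpow_le_rpow key3 (hq k).le
  rw [ENNReal.mul_rpow_of_nonneg _ _ (hq k).le, ENNReal.mul_rpow_of_nonneg _ _ (hq k).le,
    ← ENNReal.rpow_mul, ← ENNReal.rpow_mul, ← ENNReal.rpow_mul, one_div,
    inv_mul_cancel₀ (hq k).ne', ENNReal.rpow_one, ENNReal.rpow_one] at key4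
  calc _ = V * ((volume G / V) ^ (m * (P k).conjExponent) * (V⁻¹ * σ (ball c r))) := by
        rw [mul_left_comm, ← mul_assoc V, ENNReal.mul_inv_cancel hV0 hVt, one_mul]
    _ ≤ V * (V⁻¹ * σ G * C ^ (P k).conjExponent) := by gcongr
    _ = _ := by
      rw [mul_assoc, ← mul_assoc V, ENNReal.mul_inv_cancel hV0 hVt, one_mul, mul_comm,
        ENNReal.coe_rpow_of_nonneg _ (hq k).le]

/-- For `w_i ∈ A_∞`, the product of the means of the `w_i` is at most a constant times the mean of
the product weight, so that `A_P` bounds the masses of the `w_i` against those of the dual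
weights. -/
lemma IsMultiAP.exists_prod_mul_prod_le (h : IsMultiAP p P w) (hm : 0 < m)
    (hP : ∀ i, 1 < P i) (hp : 1 / p = ∑ i, 1 / P i) (hA : ∀ i, IsAInfty (w i)) :
    ∃ C : ℝ≥0, ∀ (c : Rn n) (r : ℝ), 0 < r →
      (∏ i, (∫⁻ x in ball c r, dualWeight (P i) (w i) x) ^ (1 / (P i).conjExponent)) *
        ∏ i, wMeasure (w i) (ball c r) ^ (1 / P i) ≤ C * volume (ball c r) ^ (m : ℝ) := by
  have hp0 := pos_of_one_div_eq_sum hm hP hp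
  obtain ⟨hw, C, hC⟩ := h
  have hq : ∀ i, 0 < (P i).conjExponent := fun i => conjExponent_pos (hP i)
  have hP0 : ∀ i, 0 < P i := fun i => one_pos.trans (hP i)
  choose s hs D hD using fun i => (hA i).exists_ballMean_mul_le
  have hsum0 : 0 ≤ ∑ i, p / P i / s i := Finset.sum_nonneg fun i _ => by
    have := hP0 i; have := hs i; positivity
  -- Hölder's inequality is applied to `1 = v ^ ε * ∏ (w_i ^ (-s_i)) ^ (ε * θ_i / s_i)`, where
  -- `θ_i = p / p_i`; this value of `ε` makes the exponents add up to `1`.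
  set ε : ℝ := 1 / (1 + ∑ i, p / P i / s i) with hε
  have hε0 : 0 < ε := by positivity
  refine ⟨C * ∏ i, D i ^ (1 / P i), fun c r hr => ?_⟩
  have key := ballMean_prod_rpow_le (ι := Option (Fin m)) (n := n)
    (g := fun o => o.elim (prodWeight p P w) (fun i x => ENNReal.ofReal (w i x) ^ (-s i)))
    (θ := fun o => o.elim ε (fun i => ε * (p / P i / s i)))
    (by rintro (_ | i)
        · exact aemeasurable_prodWeight hw
        · exact (hw i).aemeasurable_ofReal.pow_const _)
    (by
      rw [Fintype.sum_option]
      simp only [Option.elim]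
      rw [← Finset.mul_sum, ← mul_one_add, hε]
      exact one_div_mul_cancel (by positivity))
    (by rintro (_ | i)
        · exact hε0.le
        · have := hP0 i; have := hs i
          simp only [Option.elim]; positivity) c r
  have h1 : ballMean c r (fun x => ∏ o : Option (Fin m),
      (o.elim (prodWeight p P w) (fun i x => ENNReal.ofReal (w i x) ^ (-s i)) x) ^
        (o.elim ε (fun i => ε * (p / P i / s i)))) = 1 := by
    rw [← ballMean_one c hr]
    rw [ballMean, ballMean]
    congr 1
    refine lintegral_congr_ae (ae_restrict_of_ae ?_)
    filter_upwards [prodWeight_eq (p := p) (P := P) hw, ae_all_iff.2 fun i => (hw i).ae_ofReal]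
      with x hx hx0
    simp only [Fintype.prod_option, Option.elim]
    rw [hx, ← ENNReal.prod_rpow_of_nonneg hε0.le, ← Finset.prod_mul_distrib]
    refine Finset.prod_eq_one fun i _ => ?_
    rw [← ENNReal.rpow_mul, ← ENNReal.rpow_mul]
    convert ENNReal.rpow_mul_rpow_neg_eq_one (hx0 i) ENNReal.ofReal_ne_top (p / P i * ε) using 3
    have := (hs i).ne'
    field_simp
  rw [h1, Fintype.prod_option] at key
  simp only [Option.elim] at key
  have key2 := ENNReal.rpow_le_rpow key (z := 1 / (ε * p)) (by positivity)
  rw [ENNReal.one_rpow, ENNReal.mul_rpow_of_nonneg _ _ (by positivity), ← ENNReal.rpow_mul,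
    ← ENNReal.prod_rpow_of_nonneg (by positivity), show ε * (1 / (ε * p)) = 1 / p by field_simp]
    at key2
  set A := fun i => ballMean c r (fun x => ENNReal.ofReal (w i x))
  set S := fun i => ballMean c r (fun x => ENNReal.ofReal (w i x) ^ (-s i))
  have key3 : 1 ≤ ballMean c r (prodWeight p P w) ^ (1 / p) * ∏ i, (S i ^ (1 / s i)) ^ (1 / P i) := by
    refine key2.trans_eq ?_
    congr 1
    refine Finset.prod_congr rfl fun i _ => ?_
    rw [← ENNReal.rpow_mul, ← ENNReal.rpow_mul]
    congr 1
    have := (hs i).ne'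
    have := (hP0 i).ne'
    field_simp
  have key4 : ∏ i, A i ^ (1 / P i) ≤
      ballMean c r (prodWeight p P w) ^ (1 / p) * ∏ i, (D i : ℝ≥0∞) ^ (1 / P i) := by
    calc ∏ i, A i ^ (1 / P i) ≤ (∏ i, A i ^ (1 / P i)) * (ballMean c r (prodWeight p P w) ^ (1 / p)
          * ∏ i, (S i ^ (1 / s i)) ^ (1 / P i)) := le_mul_of_one_le_right zero_le key3
      _ = ballMean c r (prodWeight p P w) ^ (1 / p) * ∏ i, (A i * S i ^ (1 / s i)) ^ (1 / P i) := by
        rw [mul_left_comm, ← Finset.prod_mul_distrib]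
        congr 1
        refine Finset.prod_congr rfl fun i _ => ?_
        rw [ENNReal.mul_rpow_of_nonneg _ _ (by have := hP0 i; positivity)]
      _ ≤ _ := by
        refine mul_le_mul_right (Finset.prod_le_prod' fun i _ => ?_) _
        exact ENNReal.rpow_le_rpow (hD i c r hr) (by have := hP0 i; positivity)
  have hV0 := volume_ball_pos c hr
  have hVt := volume_ball_ne_top c r
  have key5 : (∏ i, ballMean c r (dualWeight (P i) (w i)) ^ (1 / (P i).conjExponent)) *
      ∏ i, A i ^ (1 / P i) ≤ C * ∏ i, (D i : ℝ≥0∞) ^ (1 / P i) := by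
    calc _ ≤ _ := mul_le_mul_right key4 _
      _ = (ballMean c r (prodWeight p P w) ^ (1 / p) *
        ∏ i, ballMean c r (dualWeight (P i) (w i)) ^ (1 / (P i).conjExponent)) *
        ∏ i, (D i : ℝ≥0∞) ^ (1 / P i) := by ring
      _ ≤ _ := mul_le_mul_left (hC c r hr) _
  have hD' : ((∏ i, D i ^ (1 / P i) : ℝ≥0) : ℝ≥0∞) = ∏ i, (D i : ℝ≥0∞) ^ (1 / P i) := by
    rw [ENNReal.ofNNReal_finsetProd]
    refine Finset.prod_congr rfl fun i _ => ?_
    rw [ENNReal.coe_rpow_of_nonneg _ (by have := hP0 i; positivity)]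
  rw [ENNReal.coe_mul, hD']
  refine le_trans (le_of_eq ?_) (mul_le_mul_left key5 _)
  simp only [A, ballMean, ← wMeasure_ball]
  rw [← Finset.prod_mul_distrib, ← Finset.prod_mul_distrib]
  have hVm : volume (ball c r) ^ (m : ℝ) = ∏ i,
      (volume (ball c r) ^ (1 / (P i).conjExponent) * volume (ball c r) ^ (1 / P i)) := by
    rw [ENNReal.rpow_natCast, ← Fin.prod_const]
    refine Finset.prod_congr rfl fun i _ => ?_
    rw [← ENNReal.rpow_add _ _ hV0 hVt, add_comm, one_div, one_div,
      (Real.HolderConjugate.conjExponent (hP i)).inv_add_inv_eq_one, ENNReal.rpow_one]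
  rw [hVm, ← Finset.prod_mul_distrib]
  refine Finset.prod_congr rfl fun i _ => ?_
  have hq' : 0 ≤ 1 / (P i).conjExponent := (one_div_pos.2 (hq i)).le
  have hP' : 0 ≤ 1 / P i := (one_div_pos.2 (hP0 i)).le
  rw [mul_mul_mul_comm, ← ENNReal.mul_rpow_of_nonneg _ _ hq', ← ENNReal.mul_rpow_of_nonneg _ _ hP',
    mul_right_comm, ENNReal.inv_mul_cancel hV0 hVt, one_mul, mul_right_comm,
    ENNReal.inv_mul_cancel hV0 hVt, one_mul]

end MultiAP

lemma volume_ball_mul (hn : 0 < n) (c : Rn n) (r : ℝ) {t : ℝ} (ht : 0 ≤ t) :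
    volume (ball c (t * r)) = ENNReal.ofReal t ^ n * volume (ball c r) := by
  have : Nonempty (Fin n) := ⟨⟨0, hn⟩⟩
  rw [Measure.addHaar_ball_mul volume c ht, finrank_euclideanSpace_fin,
    Measure.addHaar_ball_center volume c r, ENNReal.ofReal_pow ht]

lemma BallComparable.exists_doubling {ν : Measure (Rn n)} (h : BallComparable ν) (hn : 0 < n)
    {t : ℝ} (ht : 1 ≤ t) :
    ∃ C : ℝ≥0, ∀ (c : Rn n) (r : ℝ), 0 < r → ν (ball c (t * r)) ≤ C * ν (ball c r) := by
  obtain ⟨C, N, hN, hC⟩ := h.comparable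
  have ht0 : 0 < t := one_pos.trans_le ht
  refine ⟨(t.toNNReal ^ n : ℝ≥0) ^ N * C, fun c r hr => ?_⟩
  have h1 := hC c (t * r) (by positivity) (ball c r) (ball_subset_ball (by nlinarith))
    measurableSet_ball
  have hV : volume (ball c (t * r)) = (t.toNNReal ^ n : ℝ≥0) * volume (ball c r) := by
    rw [volume_ball_mul hn c r ht0.le, ENNReal.coe_pow]; rfl
  have h20 : ((t.toNNReal ^ n : ℝ≥0) : ℝ≥0∞) ≠ 0 := by
    simp only [ENNReal.coe_pow]
    exact pow_ne_zero _ (by simpa using ht0)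
  have h2 : volume (ball c r) / volume (ball c (t * r)) = ((t.toNNReal ^ n : ℝ≥0) : ℝ≥0∞)⁻¹ := by
    rw [hV, ENNReal.div_eq_inv_mul, ENNReal.mul_inv (Or.inl h20) (Or.inl ENNReal.coe_ne_top),
      mul_assoc, ENNReal.inv_mul_cancel (volume_ball_pos c hr) (volume_ball_ne_top c r), mul_one]
  rw [h2, ENNReal.inv_rpow] at h1
  rw [ENNReal.coe_mul, ENNReal.coe_rpow_of_nonneg _ hN.le, mul_assoc]
  have h3 : ((t.toNNReal ^ n : ℝ≥0) : ℝ≥0∞) ^ N ≠ 0 := by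
    rw [ne_eq, ENNReal.rpow_eq_zero_iff_of_pos hN]; exact h20
  have h4 : ((t.toNNReal ^ n : ℝ≥0) : ℝ≥0∞) ^ N ≠ ∞ :=
    ENNReal.rpow_ne_top_of_nonneg hN.le ENNReal.coe_ne_top
  calc _ = ((t.toNNReal ^ n : ℝ≥0) : ℝ≥0∞) ^ N *
        ((((t.toNNReal ^ n : ℝ≥0) : ℝ≥0∞) ^ N)⁻¹ * ν (ball c (t * r))) := by
        rw [← mul_assoc, ENNReal.mul_inv_cancel h3 h4, one_mul]
    _ ≤ _ := by gcongr

end Weights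

section JohnNirenberg

variable {n m : ℕ}

/-! ### Dyadic cubes and the Calderón–Zygmund decomposition -/

/-- The half-open cube with lower corner `a` and side `s`. -/
def cube (a : Fin n → ℝ) (s : ℝ) : Set (Rn n) := {x | ∀ i, a i ≤ x i ∧ x i < a i + s}

/-- The dyadic cube of generation `k` and index `z` in the grid generated by `cube a s`. -/
def dyadicCube (a : Fin n → ℝ) (s : ℝ) (k : ℕ) (z : Fin n → ℤ) : Set (Rn n) :=
  cube (fun i => a i + s / 2 ^ k * z i) (s / 2 ^ k)

/-- The index of the dyadic cube of generation `k` that contains `x`. -/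
noncomputable def dyadicIndex (a : Fin n → ℝ) (s : ℝ) (k : ℕ) (x : Rn n) : Fin n → ℤ :=
  fun i => ⌊2 ^ k * ((x i - a i) / s)⌋

lemma cube_eq_preimage (a : Fin n → ℝ) (s : ℝ) :
    cube a s = (MeasurableEquiv.toLp 2 (Fin n → ℝ)).symm ⁻¹'
      (univ.pi fun i => Ico (a i) (a i + s)) := by
  ext x
  simp [cube, mem_pi]

lemma measurableSet_cube (a : Fin n → ℝ) (s : ℝ) : MeasurableSet (cube a s) := by
  rw [cube_eq_preimage]
  exact (MeasurableEquiv.measurable _) (MeasurableSet.univ_pi fun i => measurableSet_Ico)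

lemma volume_cube (a : Fin n → ℝ) (s : ℝ) : volume (cube a s) = ENNReal.ofReal s ^ n := by
  rw [cube_eq_preimage, (EuclideanSpace.volume_preserving_symm_measurableEquiv_toLp
    (Fin n)).measure_preimage (MeasurableSet.univ_pi fun i => measurableSet_Ico).nullMeasurableSet,
    Real.volume_pi_Ico]
  simp

lemma volume_cube_ne_zero (a : Fin n → ℝ) {s : ℝ} (hs : 0 < s) : volume (cube a s) ≠ 0 := by
  rw [volume_cube]; exact pow_ne_zero _ (by simpa using hs)

lemma volume_cube_ne_top (a : Fin n → ℝ) (s : ℝ) : volume (cube a s) ≠ ∞ := by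
  rw [volume_cube]; finiteness

lemma cube_subset_ball_of_abs_sub_le {a : Fin n → ℝ} {s R : ℝ} (hR : 0 < R) {y : Rn n}
    (h : ∀ x ∈ cube a s, ∀ i, |x i - y i| ≤ R) : cube a s ⊆ ball y ((n + 1) * R) := by
  intro x hx
  rw [mem_ball, EuclideanSpace.dist_eq]
  have h1 : ∑ i, dist (x i) (y i) ^ 2 ≤ ((n : ℝ) * R) ^ 2 := by
    calc ∑ i, dist (x i) (y i) ^ 2 ≤ ∑ _i : Fin n, R ^ 2 := by
          refine Finset.sum_le_sum fun i _ => ?_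
          rw [Real.dist_eq]
          exact pow_le_pow_left₀ (abs_nonneg _) (h x hx i) 2
      _ = n * R ^ 2 := by simp
      _ ≤ (n : ℝ) ^ 2 * R ^ 2 := by
          gcongr
          exact_mod_cast Nat.le_self_pow two_ne_zero n
      _ = _ := by ring
  calc _ ≤ (n : ℝ) * R := Real.sqrt_le_iff.2 ⟨by positivity, h1⟩
    _ < _ := by linarith

lemma cube_subset_ball_of_mem {a : Fin n → ℝ} {s : ℝ} (hs : 0 < s) {y : Rn n}
    (hy : y ∈ cube a s) : cube a s ⊆ ball y ((n + 1) * s) :=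
  cube_subset_ball_of_abs_sub_le hs fun x hx i => by
    have h1 := hx i
    have h2 := hy i
    rw [abs_le]; constructor <;> linarith

lemma toLp_mem_cube (a : Fin n → ℝ) {s : ℝ} (hs : 0 < s) : WithLp.toLp 2 a ∈ cube a s :=
  fun i => ⟨le_rfl, by simpa using hs⟩

/-- The ratio `|B(y, (n + 1) s)| / |Q|` for a cube `Q` of side `s`. -/
noncomputable def cubeRatio (n : ℕ) : ℝ≥0∞ :=
  ((n : ℝ≥0∞) + 1) ^ n * volume (ball (0 : Rn n) 1)

lemma cubeRatio_ne_zero : cubeRatio n ≠ 0 :=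
  mul_ne_zero (pow_ne_zero _ (by simp)) (volume_ball_pos _ one_pos)

lemma cubeRatio_ne_top : cubeRatio n ≠ ∞ :=
  ENNReal.mul_ne_top (by finiteness) (volume_ball_ne_top _ _)

lemma volume_ball_eq_cubeRatio_mul (hn : 0 < n) (y : Rn n) (a : Fin n → ℝ) {s : ℝ} (hs : 0 < s) :
    volume (ball y ((n + 1) * s)) = cubeRatio n * volume (cube a s) := by
  rw [volume_ball_mul hn _ _ (by positivity)]
  rw [show ball y s = ball y (s * 1) by rw [mul_one], volume_ball_mul hn _ _ hs.le, volume_cube,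
    cubeRatio,
    Measure.addHaar_ball_center volume y 1, ENNReal.ofReal_add (by positivity) (by positivity)]
  simp only [ENNReal.ofReal_natCast, ENNReal.ofReal_one]
  ring

lemma mem_dyadicCube {a : Fin n → ℝ} {s : ℝ} (hs : 0 < s) {k : ℕ} {z : Fin n → ℤ} {x : Rn n} :
    x ∈ dyadicCube a s k z ↔ dyadicIndex a s k x = z := by
  rw [funext_iff]
  refine forall_congr' fun i => ?_
  rw [dyadicIndex, Int.floor_eq_iff]
  have h2 : (0 : ℝ) < 2 ^ k := by positivity
  refine and_congr ?_ ?_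
  · rw [← sub_nonneg, ← sub_nonneg (b := (z i : ℝ)),
      show 2 ^ k * ((x i - a i) / s) - z i = (2 ^ k / s) * (x i - (a i + s / 2 ^ k * z i)) by
        field_simp; ring, mul_nonneg_iff_of_pos_left (by positivity)]
  · rw [← sub_pos, ← sub_pos (a := (z i : ℝ) + 1),
      show z i + 1 - 2 ^ k * ((x i - a i) / s) =
        (2 ^ k / s) * (a i + s / 2 ^ k * z i + s / 2 ^ k - x i) by
        field_simp; ring, mul_pos_iff_of_pos_left (by positivity)]

lemma dyadicIndex_succ (a : Fin n → ℝ) (s : ℝ) (k : ℕ) (x : Rn n) :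
    dyadicIndex a s k x = fun i => dyadicIndex a s (k + 1) x i / 2 := by
  ext i
  have := Int.floor_div_natCast (2 ^ (k + 1) * ((x i - a i) / s)) 2
  simp only [dyadicIndex]
  push_cast at this
  rw [← this]
  congr 1
  ring

lemma dyadicIndex_eq_of_le {a : Fin n → ℝ} {s : ℝ} {j k : ℕ} (hjk : j ≤ k) {x y : Rn n}
    (h : dyadicIndex a s k x = dyadicIndex a s k y) :
    dyadicIndex a s j x = dyadicIndex a s j y := by
  induction k, hjk using Nat.le_induction with
  | base => exact h
  | succ k _ ih => exact ih (by rw [dyadicIndex_succ a s k x, dyadicIndex_succ a s k y, h])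

lemma dyadicCube_subset {a : Fin n → ℝ} {s : ℝ} (hs : 0 < s) {j k : ℕ} (hjk : j ≤ k) (x : Rn n) :
    dyadicCube a s k (dyadicIndex a s k x) ⊆ dyadicCube a s j (dyadicIndex a s j x) := by
  intro y hy
  rw [mem_dyadicCube hs] at hy ⊢
  exact dyadicIndex_eq_of_le hjk hy

lemma dyadicCube_zero (a : Fin n → ℝ) (s : ℝ) : dyadicCube a s 0 0 = cube a s := by
  simp [dyadicCube]

lemma volume_dyadicCube (a : Fin n → ℝ) (s : ℝ) (k : ℕ) (z : Fin n → ℤ) :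
    volume (dyadicCube a s k z) = ENNReal.ofReal (s / 2 ^ k) ^ n := volume_cube _ _

lemma volume_dyadicCube_succ (a : Fin n → ℝ) (s : ℝ) (k : ℕ) (z z' : Fin n → ℤ) :
    volume (dyadicCube a s k z) = 2 ^ n * volume (dyadicCube a s (k + 1) z') := by
  rw [volume_dyadicCube, volume_dyadicCube, ← mul_pow]
  congr 1
  rw [show s / 2 ^ k = 2 * (s / 2 ^ (k + 1)) by rw [pow_succ]; field_simp,
    ENNReal.ofReal_mul zero_le_two]
  simp

/-- The selection of maximal dyadic cubes in the Calderón–Zygmund decomposition of `f` at the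
height `h`. -/
lemma exists_calderonZygmund_cubes {a : Fin n → ℝ} {s : ℝ} (hs : 0 < s) (f : Rn n → ℝ≥0∞)
    (h : ℝ≥0∞) (hf : ∫⁻ x in cube a s, f x ≤ h * volume (cube a s)) :
    ∃ S : Set (ℕ × (Fin n → ℤ)), S.PairwiseDisjoint (fun κ => dyadicCube a s κ.1 κ.2) ∧
      (∀ κ ∈ S, dyadicCube a s κ.1 κ.2 ⊆ cube a s ∧
        h * volume (dyadicCube a s κ.1 κ.2) ≤ ∫⁻ x in dyadicCube a s κ.1 κ.2, f x ∧
        ∫⁻ x in dyadicCube a s κ.1 κ.2, f x ≤ 2 ^ n * h * volume (dyadicCube a s κ.1 κ.2)) ∧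
      ∀ x ∈ cube a s, (∀ κ ∈ S, x ∉ dyadicCube a s κ.1 κ.2) →
        ∀ k, ∫⁻ y in dyadicCube a s k (dyadicIndex a s k x), f y ≤
          h * volume (dyadicCube a s k (dyadicIndex a s k x)) := by
  set D : ℕ → Rn n → Set (Rn n) := fun k x => dyadicCube a s k (dyadicIndex a s k x) with hD
  have hxD : ∀ k x, x ∈ D k x := fun k x => (mem_dyadicCube hs).2 rfl
  have hD0 : ∀ x ∈ cube a s, D 0 x = cube a s := by
    intro x hx
    rw [← dyadicCube_zero, mem_dyadicCube hs] at hx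
    rw [hD]; simp only; rw [hx, dyadicCube_zero]
  set bad : ℕ → Rn n → Prop := fun k x => h * volume (D k x) < ∫⁻ y in D k x, f y with hbad
  have hcongr : ∀ {k j x y}, dyadicIndex a s k x = dyadicIndex a s k y → j ≤ k →
      (bad j x ↔ bad j y) := by
    intro k j x y hxy hj
    simp only [hbad, hD, dyadicIndex_eq_of_le hj hxy]
  -- the cubes that are bad while all their ancestors inside `cube a s` are good
  refine ⟨{κ | ∃ x ∈ cube a s, dyadicIndex a s κ.1 x = κ.2 ∧ bad κ.1 x ∧ ∀ j < κ.1, ¬ bad j x},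
    ?_, ?_, ?_⟩
  · rintro ⟨k, z⟩ ⟨x, -, hxz, hx1, hx2⟩ ⟨k', z'⟩ ⟨x', -, hxz', hx1', hx2'⟩ hne
    rw [Function.onFun, Set.disjoint_left]
    intro y hy hy'
    rw [mem_dyadicCube hs] at hy hy'
    simp only at hxz hxz' hy hy' hx1 hx1' hx2 hx2'
    have e : dyadicIndex a s k x = dyadicIndex a s k y := hxz.trans hy.symm
    have e' : dyadicIndex a s k' x' = dyadicIndex a s k' y := hxz'.trans hy'.symm
    have hkk : k = k' := by
      rcases lt_trichotomy k k' with hlt | heq | hlt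
      · exact absurd ((hcongr e le_rfl).1 hx1) fun hb => hx2' k hlt ((hcongr e' hlt.le).2 hb)
      · exact heq
      · exact absurd ((hcongr e' le_rfl).1 hx1') fun hb => hx2 k' hlt ((hcongr e hlt.le).2 hb)
    subst hkk
    exact hne (by rw [← hy, ← hy'])
  · rintro ⟨k, z⟩ ⟨x, hxQ, hxz, hx1, hx2⟩
    simp only at hxz hx1 hx2
    subst hxz
    have hk : k ≠ 0 := by
      rintro rfl
      simp only [hbad, hD0 x hxQ] at hx1
      exact hx1.not_ge hf
    obtain ⟨j, rfl⟩ := Nat.exists_eq_succ_of_ne_zero hk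
    refine ⟨?_, hx1.le, ?_⟩
    · rw [← hD0 x hxQ]
      exact dyadicCube_subset hs (Nat.zero_le _) x
    · have := not_lt.1 (hx2 j (Nat.lt_succ_self j))
      calc _ ≤ ∫⁻ y in D j x, f y := lintegral_mono_set (dyadicCube_subset hs (Nat.le_succ j) x)
        _ ≤ h * volume (D j x) := this
        _ = _ := by
          rw [hD]; simp only
          rw [volume_dyadicCube_succ a s j _ (dyadicIndex a s (j + 1) x)]
          simp only [Nat.succ_eq_add_one]; ring
  · intro x hxQ hx k
    by_contra hcon
    have hex : ∃ k, bad k x := ⟨k, not_le.1 hcon⟩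
    classical
    exact hx (Nat.find hex, dyadicIndex a s (Nat.find hex) x)
      ⟨x, hxQ, rfl, Nat.find_spec hex, fun j hj => Nat.find_min hex hj⟩ (hxD _ x)

section BMO

variable {𝕜 : Type*} [RCLike 𝕜] {b : Rn n → 𝕜}

/-- Differentiation along dyadic cubes. -/
lemma ae_enorm_sub_le_of_dyadic (hn : 0 < n) (hb : LocallyIntegrable b volume) :
    ∀ᵐ x, ∀ (a : Fin n → ℝ) (s : ℝ) (c : 𝕜) (h : ℝ≥0∞), 0 < s →
      (∀ k, ∫⁻ y in dyadicCube a s k (dyadicIndex a s k x), ‖b y - c‖ₑ ≤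
        h * volume (dyadicCube a s k (dyadicIndex a s k x))) → ‖b x - c‖ₑ ≤ h := by
  have : Nonempty (Fin n) := ⟨⟨0, hn⟩⟩
  filter_upwards [IsUnifLocDoublingMeasure.ae_tendsto_average_norm_sub (volume : Measure (Rn n))
    hb 1] with x hx a s c h hs hh
  set δ : ℕ → ℝ := fun k => (n + 1) * (s / 2 ^ k) with hδ
  have hδ0 : ∀ k, 0 < δ k := fun k => by positivity
  have hlim : Filter.Tendsto δ Filter.atTop (nhdsWithin 0 (Ioi 0)) := by
    refine tendsto_nhdsWithin_iff.2 ⟨?_, Filter.Eventually.of_forall hδ0⟩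
    have h1 := (tendsto_pow_atTop_nhds_zero_of_lt_one (r := (1 / 2 : ℝ)) (by norm_num)
      (by norm_num)).const_mul ((n + 1) * s)
    rw [mul_zero] at h1
    refine h1.congr fun k => ?_
    simp only [hδ]
    rw [one_div, inv_pow]
    ring
  have hx1 := hx (fun _ => x) δ hlim (Filter.Eventually.of_forall fun k => by
    rw [one_mul]; exact mem_closedBall_self (hδ0 k).le)
  have hx2 : Filter.Tendsto (fun k => cubeRatio n *
      ENNReal.ofReal (⨍ y in closedBall x (δ k), ‖b y - b x‖) + h) Filter.atTop (nhds h) := by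
    have := (ENNReal.Tendsto.const_mul (a := cubeRatio n) (ENNReal.tendsto_ofReal hx1)
      (Or.inr cubeRatio_ne_top)).add_const h
    simpa using this
  refine ge_of_tendsto' hx2 fun k => ?_
  have hsk : 0 < s / 2 ^ k := by positivity
  set Q := dyadicCube a s k (dyadicIndex a s k x) with hQ
  have hxQ : x ∈ Q := (mem_dyadicCube hs).2 rfl
  have hQ0 : volume Q ≠ 0 := volume_cube_ne_zero _ hsk
  have hQt : volume Q ≠ ∞ := volume_cube_ne_top _ _
  have hQB : Q ⊆ closedBall x (δ k) := (cube_subset_ball_of_mem hsk hxQ).trans ball_subset_closedBall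
  have hB : volume (closedBall x (δ k)) = cubeRatio n * volume Q := by
    rw [Measure.addHaar_closedBall_eq_addHaar_ball]
    exact volume_ball_eq_cubeRatio_mul hn x _ hsk
  have hbint : IntegrableOn (fun y => b y - b x) (closedBall x (δ k)) volume :=
    (hb.integrableOn_isCompact (isCompact_closedBall _ _)).sub
      (integrableOn_const (measure_closedBall_lt_top).ne)
  have havg : ENNReal.ofReal (⨍ y in closedBall x (δ k), ‖b y - b x‖) =
      (volume (closedBall x (δ k)))⁻¹ * ∫⁻ y in closedBall x (δ k), ‖b y - b x‖ₑ := by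
    rw [setAverage_eq, smul_eq_mul, ENNReal.ofReal_mul (by positivity),
      ofReal_integral_norm_eq_lintegral_enorm hbint, Measure.real,
      ENNReal.ofReal_inv_of_pos, ENNReal.ofReal_toReal measure_closedBall_lt_top.ne]
    rw [ENNReal.toReal_pos_iff, hB]
    exact ⟨pos_iff_ne_zero.2 (mul_ne_zero cubeRatio_ne_zero hQ0),
      (ENNReal.mul_ne_top cubeRatio_ne_top hQt).lt_top⟩
  rw [havg, hB, ENNReal.mul_inv (Or.inl cubeRatio_ne_zero) (Or.inl cubeRatio_ne_top), mul_assoc,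
    ← mul_assoc (cubeRatio n), ENNReal.mul_inv_cancel cubeRatio_ne_zero cubeRatio_ne_top, one_mul]
  have hmeas : AEMeasurable (fun y => ‖b y - b x‖ₑ) (volume.restrict Q) :=
    (hb.aestronglyMeasurable.sub aestronglyMeasurable_const).enorm.restrict
  have key : ‖b x - c‖ₑ * volume Q ≤
      (∫⁻ y in closedBall x (δ k), ‖b y - b x‖ₑ) + h * volume Q := by
    calc ‖b x - c‖ₑ * volume Q = ∫⁻ y in Q, ‖b x - c‖ₑ := by simp
      _ ≤ ∫⁻ y in Q, (‖b y - b x‖ₑ + ‖b y - c‖ₑ) := by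
        refine lintegral_mono fun y => ?_
        rw [← enorm_neg (b y - b x), neg_sub]
        calc ‖b x - c‖ₑ = ‖(b x - b y) + (b y - c)‖ₑ := by congr 1; ring
          _ ≤ _ := enorm_add_le _ _
      _ = (∫⁻ y in Q, ‖b y - b x‖ₑ) + ∫⁻ y in Q, ‖b y - c‖ₑ := lintegral_add_left' hmeas _
      _ ≤ _ := add_le_add (lintegral_mono_set hQB) (hh k)
  calc ‖b x - c‖ₑ = (volume Q)⁻¹ * (‖b x - c‖ₑ * volume Q) := by
        rw [mul_left_comm, ENNReal.inv_mul_cancel hQ0 hQt, mul_one]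
    _ ≤ (volume Q)⁻¹ * ((∫⁻ y in closedBall x (δ k), ‖b y - b x‖ₑ) + h * volume Q) := by gcongr
    _ = _ := by
      rw [mul_add, mul_left_comm _ h, ENNReal.inv_mul_cancel hQ0 hQt, mul_one]

lemma enorm_setAverage_sub_le {E : Set (Rn n)} (h0 : volume E ≠ 0) (ht : volume E ≠ ∞)
    (hb : IntegrableOn b E volume) (c : 𝕜) :
    ‖(⨍ y in E, b y) - c‖ₑ * volume E ≤ ∫⁻ y in E, ‖b y - c‖ₑ := by
  have h1 : ∫ y in E, (b y - c) = (∫ y in E, b y) - volume.real E • c := by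
    rw [integral_sub hb (integrableOn_const ht)]; simp
  have h2 : 0 < volume.real E := ENNReal.toReal_pos h0 ht
  have h3 : ∫ y in E, (b y - c) = volume.real E • ((⨍ y in E, b y) - c) := by
    rw [h1, setAverage_eq, smul_sub, smul_inv_smul₀ h2.ne']
  calc _ = ‖∫ y in E, (b y - c)‖ₑ := by
        rw [h3, enorm_smul, mul_comm, Real.enorm_of_nonneg h2.le, Measure.real,
          ENNReal.ofReal_toReal ht]
    _ ≤ _ := enorm_integral_le_lintegral_enorm _

lemma integrableOn_cube (hb : LocallyIntegrable b volume) (a : Fin n → ℝ) {s : ℝ} (hs : 0 < s) :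
    IntegrableOn b (cube a s) volume :=
  (hb.integrableOn_isCompact (isCompact_closedBall (WithLp.toLp 2 a) ((n + 1) * s))).mono_set
    ((cube_subset_ball_of_mem hs (toLp_mem_cube a hs)).trans ball_subset_closedBall)

end BMO

/-! ### The John–Nirenberg inequality for weights -/

/-- A set filling at most half of a cube has at most `γ < 1` times the mass of the cube. -/
lemma BallComparable.exists_cube_le {ν : Measure (Rn n)} (h : BallComparable ν) (hn : 0 < n) :
    ∃ γ : ℝ≥0, γ < 1 ∧ ∀ (a : Fin n → ℝ) (s : ℝ), 0 < s → ∀ E ⊆ cube a s, MeasurableSet E →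
      volume E ≤ 2⁻¹ * volume (cube a s) → ν E ≤ γ * ν (cube a s) := by
  obtain ⟨C, N, hN, hC⟩ := h.comparable
  have hκ0 := cubeRatio_ne_zero (n := n)
  have hκt := cubeRatio_ne_top (n := n)
  have ht0 : (2 * cubeRatio n) ^ N ≠ 0 := by
    rw [ne_eq, ENNReal.rpow_eq_zero_iff_of_pos hN]
    exact mul_ne_zero two_ne_zero hκ0
  have htt : (2 * cubeRatio n) ^ N ≠ ∞ :=
    ENNReal.rpow_ne_top_of_nonneg hN.le (ENNReal.mul_ne_top ENNReal.ofNat_ne_top hκt)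
  -- `ν Q ≤ D * ν (Q \ E)`; the summand `1` ensures `D ≥ 1`
  set D : ℝ≥0 := ((2 * cubeRatio n) ^ N).toNNReal * C + 1 with hD
  have hD1 : 1 ≤ D := by simp [hD]
  have hD0 : D ≠ 0 := (one_pos.trans_le hD1).ne'
  refine ⟨1 - D⁻¹, tsub_lt_self one_pos (by positivity), fun a s hs E hE hEm hvol => ?_⟩
  have hQB := cube_subset_ball_of_mem hs (toLp_mem_cube a hs)
  set y : Rn n := WithLp.toLp 2 a
  set Q := cube a s with hQ
  have hR : 0 < ((n : ℝ) + 1) * s := by positivity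
  have hB := volume_ball_eq_cubeRatio_mul hn y a hs
  have hQ0 := volume_cube_ne_zero a hs
  have hQt := volume_cube_ne_top a s
  have hνQ : ν Q ≠ ∞ := ((measure_mono hQB).trans_lt (h.ball_lt_top _ _)).ne
  have hGm : MeasurableSet (Q \ E) := (measurableSet_cube a s).diff hEm
  have h1 := hC y _ hR (Q \ E) (sdiff_subset.trans hQB) hGm
  have h2 : 2⁻¹ * volume Q ≤ volume (Q \ E) := by
    rw [measure_sdiff hE hEm.nullMeasurableSet (ne_top_of_le_ne_top hQt (measure_mono hE))]
    refine ENNReal.le_sub_of_add_le_left (ne_top_of_le_ne_top hQt (measure_mono hE)) ?_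
    calc _ ≤ 2⁻¹ * volume Q + 2⁻¹ * volume Q := by gcongr
      _ = _ := by rw [← add_mul, ENNReal.inv_two_add_inv_two, one_mul]
  have h3 : (2 * cubeRatio n)⁻¹ ≤ volume (Q \ E) / volume (ball y ((n + 1) * s)) := by
    rw [ENNReal.le_div_iff_mul_le (Or.inl (volume_ball_pos y hR)) (Or.inl (volume_ball_ne_top _ _)),
      hB, ENNReal.mul_inv (Or.inl two_ne_zero) (Or.inl ENNReal.ofNat_ne_top), mul_assoc,
      ← mul_assoc (cubeRatio n)⁻¹, ENNReal.inv_mul_cancel hκ0 hκt, one_mul]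
    exact h2
  have h4 : ν Q ≤ D * ν (Q \ E) := by
    have h5 : ((2 * cubeRatio n) ^ N)⁻¹ * ν Q ≤ C * ν (Q \ E) := by
      refine le_trans ?_ h1
      rw [← ENNReal.inv_rpow]
      exact mul_le_mul' (ENNReal.rpow_le_rpow h3 hN.le) (measure_mono hQB)
    calc ν Q = (2 * cubeRatio n) ^ N * (((2 * cubeRatio n) ^ N)⁻¹ * ν Q) := by
          rw [← mul_assoc, ENNReal.mul_inv_cancel ht0 htt, one_mul]
      _ ≤ (2 * cubeRatio n) ^ N * (C * ν (Q \ E)) := by gcongr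
      _ ≤ _ := by
        rw [hD, ENNReal.coe_add, ENNReal.coe_mul, ENNReal.coe_toNNReal htt, add_mul, mul_assoc]
        exact le_self_add
  have hDE0 : (D : ℝ≥0∞) ≠ 0 := by exact_mod_cast hD0
  have h6 : (D : ℝ≥0∞)⁻¹ * ν Q ≤ ν (Q \ E) := by
    calc _ ≤ (D : ℝ≥0∞)⁻¹ * (D * ν (Q \ E)) := by gcongr
      _ = _ := by rw [← mul_assoc, ENNReal.inv_mul_cancel hDE0 ENNReal.coe_ne_top, one_mul]
  have h7 : ν E + ν (Q \ E) = ν Q := by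
    have := measure_inter_add_sdiff (μ := ν) Q hEm
    rwa [inter_eq_right.2 hE] at this
  have h8 : ((1 - D⁻¹ : ℝ≥0) : ℝ≥0∞) * ν Q + (D : ℝ≥0∞)⁻¹ * ν Q = ν Q := by
    rw [← add_mul, ← ENNReal.coe_inv hD0, ← ENNReal.coe_add,
      tsub_add_cancel_of_le (inv_le_one_of_one_le₀ hD1), ENNReal.coe_one, one_mul]
  have hfin : (D : ℝ≥0∞)⁻¹ * ν Q ≠ ∞ := ne_top_of_le_ne_top hνQ 
    (h6.trans (measure_mono sdiff_subset))
  refine (ENNReal.add_le_add_iff_right hfin).1 ?_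
  rw [h8]
  calc _ ≤ ν E + ν (Q \ E) := by gcongr
    _ = _ := h7

section BMO

variable {𝕜 : Type*} [RCLike 𝕜] {b : Rn n → 𝕜}

lemma lintegral_cube_sub_average_le (hn : 0 < n) (hb : LocallyIntegrable b volume) {M : ℝ≥0∞}
    (hM : bmoNorm b ≤ M) (a : Fin n → ℝ) {s : ℝ} (hs : 0 < s) :
    ∫⁻ x in cube a s, ‖b x - ⨍ y in cube a s, b y‖ₑ ≤
      2 * cubeRatio n * M * volume (cube a s) := by
  have hQB := cube_subset_ball_of_mem hs (toLp_mem_cube a hs)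
  have hB := volume_ball_eq_cubeRatio_mul hn (WithLp.toLp 2 a) a hs
  have hR : 0 < ((n : ℝ) + 1) * s := by positivity
  have hB0 := volume_ball_pos (WithLp.toLp 2 a : Rn n) hR
  have hBt := volume_ball_ne_top (WithLp.toLp 2 a : Rn n) ((n + 1) * s)
  set B := ball (WithLp.toLp 2 a : Rn n) ((n + 1) * s) with hBdef
  set Q := cube a s with hQ
  set c := ⨍ y in B, b y with hc
  have h1 : ∫⁻ x in Q, ‖b x - c‖ₑ ≤ cubeRatio n * M * volume Q := by
    have h2 : ballMean (WithLp.toLp 2 a : Rn n) ((n + 1) * s) (fun x => ‖b x - c‖ₑ) ≤ M :=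
      
      le_trans (le_iSup₂_of_le (f := fun (c : Rn n) (r : ℝ) => ⨆ (_ : 0 < r),
        ballMean c r (fun x => ‖b x - ⨍ y in ball c r, b y‖ₑ)) _ _ (le_iSup_of_le hR le_rfl)) hM
    calc _ ≤ ∫⁻ x in B, ‖b x - c‖ₑ := lintegral_mono_set hQB
      _ = volume B * ballMean (WithLp.toLp 2 a : Rn n) ((n + 1) * s) (fun x => ‖b x - c‖ₑ) := by
        rw [ballMean, ← mul_assoc, ENNReal.mul_inv_cancel hB0 hBt, one_mul]
      _ ≤ volume B * M := by gcongr
      _ = _ := by rw [hB]; ring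
  calc ∫⁻ x in Q, ‖b x - ⨍ y in Q, b y‖ₑ
      ≤ ∫⁻ x in Q, (‖b x - c‖ₑ + ‖(⨍ y in Q, b y) - c‖ₑ) := by
        refine lintegral_mono fun x => ?_
        rw [show b x - (⨍ y in Q, b y) = (b x - c) - ((⨍ y in Q, b y) - c) by ring]
        exact enorm_sub_le
    _ = (∫⁻ x in Q, ‖b x - c‖ₑ) + ‖(⨍ y in Q, b y) - c‖ₑ * volume Q := by
        rw [lintegral_add_right _ measurable_const]; simp
    _ ≤ (∫⁻ x in Q, ‖b x - c‖ₑ) + ∫⁻ x in Q, ‖b x - c‖ₑ := by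
        gcongr
        exact enorm_setAverage_sub_le (volume_cube_ne_zero a hs) (volume_cube_ne_top a s)
          (integrableOn_cube hb a hs) c
    _ ≤ cubeRatio n * M * volume Q + cubeRatio n * M * volume Q := by gcongr
    _ = _ := by ring

/-- The John–Nirenberg inequality with respect to a measure `ν` that loses a fixed proportion of
mass on sets filling half of a cube. In the Calderón–Zygmund decomposition of `|b - b_Q|` at the
height `2M` the selected cubes fill at most half of `Q`, their means differ from `b_Q` by at most
`2 ^ n * 2M`, and the estimate is applied in each of them. -/
lemma measure_cube_le_pow {ν : Measure (Rn n)} (hν : ν ≪ volume) {γ : ℝ≥0}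
    (hγ : ∀ (a : Fin n → ℝ) (s : ℝ), 0 < s → ∀ E ⊆ cube a s, MeasurableSet E →
      volume E ≤ 2⁻¹ * volume (cube a s) → ν E ≤ γ * ν (cube a s))
    (hn : 0 < n) (hb : LocallyIntegrable b volume) {M : ℝ≥0∞} (hM0 : M ≠ 0) (hMt : M ≠ ∞)
    (hM : ∀ (a : Fin n → ℝ) (s : ℝ), 0 < s →
      ∫⁻ x in cube a s, ‖b x - ⨍ y in cube a s, b y‖ₑ ≤ M * volume (cube a s)) (k : ℕ) :
    ∀ (a : Fin n → ℝ) (s : ℝ), 0 < s →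
      ν {x ∈ cube a s | k * (2 ^ n * (2 * M)) < ‖b x - ⨍ y in cube a s, b y‖ₑ} ≤
        γ ^ k * ν (cube a s) := by
  induction k with
  | zero =>
    intro a s hs
    rw [pow_zero, one_mul]
    exact measure_mono fun x hx => hx.1
  | succ k ih =>
    intro a s hs
    set c := ⨍ y in cube a s, b y with hc
    have hle : ∫⁻ x in cube a s, ‖b x - c‖ₑ ≤ (2 * M) * volume (cube a s) := by
      refine (hM a s hs).trans ?_
      gcongr
      exact le_mul_of_one_le_left zero_le one_le_two
    obtain ⟨S, hSd, hS, hSc⟩ := exists_calderonZygmund_cubes hs (fun x => ‖b x - c‖ₑ) (2 * M) hle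
    have hScount : S.Countable := S.to_countable
    have hmeas : ∀ κ ∈ S, MeasurableSet (dyadicCube a s κ.1 κ.2) := fun κ _ =>
      measurableSet_cube _ _
    set E := ⋃ κ ∈ S, dyadicCube a s κ.1 κ.2 with hE
    have hEm : MeasurableSet E := MeasurableSet.biUnion hScount hmeas
    have hEQ : E ⊆ cube a s := iUnion₂_subset fun κ hκ => (hS κ hκ).1
    have hEvol : volume E ≤ 2⁻¹ * volume (cube a s) := by
      have h1 : (2 * M) * volume E ≤ M * volume (cube a s) := by
        calc (2 * M) * volume E
            = ∑' κ : S, (2 * M) * volume (dyadicCube a s κ.1.1 κ.1.2) := by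
              rw [hE, measure_biUnion hScount hSd hmeas, ENNReal.tsum_mul_left]
          _ ≤ ∑' κ : S, ∫⁻ x in dyadicCube a s κ.1.1 κ.1.2, ‖b x - c‖ₑ :=
              ENNReal.tsum_le_tsum fun κ => (hS κ.1 κ.2).2.1
          _ = ∫⁻ x in E, ‖b x - c‖ₑ := by
              rw [hE, lintegral_biUnion hScount hmeas hSd]
          _ ≤ ∫⁻ x in cube a s, ‖b x - c‖ₑ := lintegral_mono_set hEQ
          _ ≤ _ := hM a s hs
      calc volume E = (2 * M)⁻¹ * ((2 * M) * volume E) := by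
            rw [← mul_assoc, ENNReal.inv_mul_cancel (mul_ne_zero two_ne_zero hM0)
              (ENNReal.mul_ne_top ENNReal.ofNat_ne_top hMt), one_mul]
        _ ≤ (2 * M)⁻¹ * (M * volume (cube a s)) := by gcongr
        _ = _ := by
          rw [ENNReal.mul_inv (Or.inl two_ne_zero) (Or.inl ENNReal.ofNat_ne_top), mul_assoc,
            ← mul_assoc M⁻¹, ENNReal.inv_mul_cancel hM0 hMt, one_mul]
    have hMn : 2 * M ≤ 2 ^ n * (2 * M) := le_mul_of_one_le_left zero_le (one_le_pow₀ one_le_two)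
    have hsub : {x ∈ cube a s | ((k + 1 : ℕ) : ℝ≥0∞) * (2 ^ n * (2 * M)) < ‖b x - c‖ₑ} ≤ᵐ[ν]
        ⋃ κ ∈ S, {x ∈ dyadicCube a s κ.1 κ.2 | k * (2 ^ n * (2 * M)) <
          ‖b x - ⨍ y in dyadicCube a s κ.1 κ.2, b y‖ₑ} := by
      filter_upwards [hν.ae_le (ae_enorm_sub_le_of_dyadic hn hb)] with x hx hxm
      obtain ⟨hxQ, hxb⟩ := hxm
      by_cases hxE : ∃ κ ∈ S, x ∈ dyadicCube a s κ.1 κ.2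
      · obtain ⟨κ, hκ, hxκ⟩ := hxE
        refine mem_iUnion₂.2 ⟨κ, hκ, hxκ, ?_⟩
        have hsκ : 0 < s / 2 ^ κ.1 := by positivity
        have hκ0 : volume (dyadicCube a s κ.1 κ.2) ≠ 0 := volume_cube_ne_zero _ hsκ
        have hκt : volume (dyadicCube a s κ.1 κ.2) ≠ ∞ := volume_cube_ne_top _ _
        set d := ⨍ y in dyadicCube a s κ.1 κ.2, b y
        have hd : ‖d - c‖ₑ ≤ 2 ^ n * (2 * M) := by
          have := (enorm_setAverage_sub_le hκ0 hκt (integrableOn_cube hb _ hsκ) c).trans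
            (hS κ hκ).2.2
          rwa [ENNReal.mul_le_mul_iff_left hκ0 hκt] at this
        have htri : ‖b x - c‖ₑ ≤ ‖b x - d‖ₑ + ‖d - c‖ₑ := by
          calc ‖b x - c‖ₑ = ‖(b x - d) + (d - c)‖ₑ := by congr 1; ring
            _ ≤ _ := enorm_add_le _ _
        by_contra hcon
        have hcon' : ‖b x - d‖ₑ ≤ k * (2 ^ n * (2 * M)) := not_lt.1 hcon
        refine hxb.not_ge (htri.trans ?_)
        push_cast
        rw [add_mul, one_mul]
        exact add_le_add hcon' hd
      · push Not at hxE
        have h1 := hx a s c (2 * M) hs (hSc x hxQ hxE)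
        refine absurd hxb (not_lt.2 (h1.trans (hMn.trans ?_)))
        exact le_mul_of_one_le_left zero_le (by simp)
    calc _ ≤ _ := measure_mono_ae hsub
      _ ≤ ∑' κ : S, ν {x ∈ dyadicCube a s κ.1.1 κ.1.2 | k * (2 ^ n * (2 * M)) <
          ‖b x - ⨍ y in dyadicCube a s κ.1.1 κ.1.2, b y‖ₑ} := measure_biUnion_le _ hScount _
      _ ≤ ∑' κ : S, γ ^ k * ν (dyadicCube a s κ.1.1 κ.1.2) :=
          ENNReal.tsum_le_tsum fun κ => ih _ _ (by positivity)
      _ = γ ^ k * ν E := by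
          rw [ENNReal.tsum_mul_left, hE, measure_biUnion hScount hSd hmeas]
      _ ≤ γ ^ k * (γ * ν (cube a s)) := by
          gcongr
          exact hγ a s hs E hEQ hEm hEvol
      _ = _ := by rw [pow_succ, mul_assoc]

/-- A discrete layer-cake bound. -/
lemma rpow_le_tsum_indicator {s : ℝ} (hs : 0 < s) {u L : ℝ≥0∞} (hu : u ≠ ∞) (hL : L ≠ 0) :
    u ^ s ≤ ∑' k : ℕ, if k * L < u then (((k : ℝ≥0∞) + 1) * L) ^ s else 0 := by
  rcases eq_or_ne u 0 with rfl | hu0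
  · simp [ENNReal.zero_rpow_of_pos hs]
  have hex : ∃ k : ℕ, u ≤ ((k : ℝ≥0∞) + 1) * L := by
    obtain ⟨k, hk⟩ := ENNReal.exists_nat_mul_gt hL hu
    exact ⟨k, hk.le.trans (by gcongr; exact le_self_add)⟩
  classical
  obtain ⟨k, hkdef⟩ : ∃ k, k = Nat.find hex := ⟨_, rfl⟩
  have hk := Nat.find_spec hex
  rw [← hkdef] at hk
  have hlt : k * L < u := by
    rcases Nat.eq_zero_or_pos k with h0 | h0
    · rw [h0]; simpa using pos_iff_ne_zero.2 hu0
    · have := Nat.find_min hex (m := k - 1) (by omega)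
      rw [not_le] at this
      refine lt_of_eq_of_lt ?_ this
      congr 1
      have : (k - 1) + 1 = k := Nat.sub_add_cancel h0
      exact_mod_cast this.symm
  calc u ^ s ≤ (((k : ℝ≥0∞) + 1) * L) ^ s := ENNReal.rpow_le_rpow hk hs.le
    _ = if k * L < u then (((k : ℝ≥0∞) + 1) * L) ^ s else 0 := by rw [if_pos hlt]
    _ ≤ _ := ENNReal.le_tsum (f := fun k : ℕ => if k * L < u then
        (((k : ℝ≥0∞) + 1) * L) ^ s else 0) k

lemma tsum_rpow_mul_geometric_ne_top {γ : ℝ≥0} (hγ : γ < 1) (s : ℝ) :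
    ∑' k : ℕ, ((k : ℝ≥0∞) + 1) ^ s * (γ : ℝ≥0∞) ^ k ≠ ∞ := by
  obtain ⟨N, hN⟩ := exists_nat_ge s
  have hsum : Summable fun k : ℕ => (2 : ℝ≥0) ^ N * (((k : ℝ≥0) ^ N + 1) * γ ^ k) := by
    refine Summable.mul_left _ ?_
    simp_rw [add_mul, one_mul]
    refine Summable.add ?_ (NNReal.summable_geometric hγ)
    rw [← NNReal.summable_coe]
    push_cast
    exact summable_pow_mul_geometric_of_norm_lt_one N (by simpa using hγ)
  refine ne_top_of_le_ne_top (ENNReal.tsum_coe_ne_top_iff_summable.2 hsum)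
    (ENNReal.tsum_le_tsum fun k => ?_)
  have h1 : ((k : ℝ≥0∞) + 1) ^ s ≤ ((k : ℝ≥0∞) + 1) ^ N := by
    rw [← ENNReal.rpow_natCast]
    exact ENNReal.rpow_le_rpow_of_exponent_le (by simp) hN
  have h2 : (k + 1) ^ N ≤ 2 ^ N * (k ^ N + 1) := by
    rcases Nat.eq_zero_or_pos k with rfl | hk
    · rw [zero_add, one_pow]
      exact Nat.one_le_iff_ne_zero.2 (by positivity)
    · calc (k + 1) ^ N ≤ (2 * k) ^ N := Nat.pow_le_pow_left (by omega) N
        _ = 2 ^ N * k ^ N := mul_pow _ _ _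
        _ ≤ _ := Nat.mul_le_mul_left _ (Nat.le_succ _)
  have h3 : ((k : ℝ≥0∞) + 1) ^ N ≤ 2 ^ N * ((k : ℝ≥0∞) ^ N + 1) := by exact_mod_cast h2
  push_cast
  rw [← mul_assoc]
  exact mul_le_mul_left (h1.trans h3) _

/-- The moments of a function of bounded mean oscillation on a cube. -/
lemma BallComparable.exists_lintegral_cube_rpow_le {ν : Measure (Rn n)} (h : BallComparable ν)
    (hn : 0 < n) {q : ℝ} (hq : 0 < q) (𝕜 : Type*) [RCLike 𝕜] :
    ∃ C : ℝ≥0, ∀ b : Rn n → 𝕜, LocallyIntegrable b volume → ∀ M : ℝ≥0∞, M ≠ 0 → M ≠ ∞ →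
      bmoNorm b ≤ M → ∀ (a : Fin n → ℝ) (s : ℝ), 0 < s →
      ∫⁻ x in cube a s, ‖b x - ⨍ y in cube a s, b y‖ₑ ^ q ∂ν ≤ C * M ^ q * ν (cube a s) := by
  obtain ⟨γ, hγ1, hγ⟩ := h.exists_cube_le hn
  have hκ0 := cubeRatio_ne_zero (n := n)
  have hκt := cubeRatio_ne_top (n := n)
  set D : ℝ≥0∞ := 2 ^ n * (2 * (2 * cubeRatio n)) with hD
  have hDt : D ≠ ∞ := by finiteness
  set K := D ^ q * ∑' k : ℕ, ((k : ℝ≥0∞) + 1) ^ q * (γ : ℝ≥0∞) ^ k with hK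
  have hKt : K ≠ ∞ := ENNReal.mul_ne_top (ENNReal.rpow_ne_top_of_nonneg hq.le hDt)
    (tsum_rpow_mul_geometric_ne_top hγ1 q)
  refine ⟨K.toNNReal, fun b hb M hM0 hMt hM a s hs => ?_⟩
  rw [ENNReal.coe_toNNReal hKt]
  have hJN := measure_cube_le_pow h.ac hγ hn hb (M := 2 * cubeRatio n * M)
    (mul_ne_zero (mul_ne_zero two_ne_zero hκ0) hM0)
    (ENNReal.mul_ne_top (ENNReal.mul_ne_top ENNReal.ofNat_ne_top hκt) hMt)
    (fun a s hs => lintegral_cube_sub_average_le hn hb hM a hs)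
  have hDM : 2 ^ n * (2 * (2 * cubeRatio n * M)) = D * M := by rw [hD]; ring
  rw [hDM] at hJN
  have hDM0 : D * M ≠ 0 := by
    refine mul_ne_zero (mul_ne_zero (by simp) (mul_ne_zero two_ne_zero ?_)) hM0
    exact mul_ne_zero two_ne_zero hκ0
  set c := ⨍ y in cube a s, b y with hc
  have hbm : AEMeasurable (fun x => ‖b x - c‖ₑ) (ν.restrict (cube a s)) :=
    ((hb.aestronglyMeasurable.mono_ac h.ac).sub aestronglyMeasurable_const).enorm.restrict
  have hset : ∀ k : ℕ, NullMeasurableSet {x | k * (D * M) < ‖b x - c‖ₑ} (ν.restrict (cube a s)) :=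
    fun k => nullMeasurableSet_lt aemeasurable_const hbm
  have hind : ∀ k : ℕ, (fun x => if k * (D * M) < ‖b x - c‖ₑ then
      (((k : ℝ≥0∞) + 1) * (D * M)) ^ q else 0) = {x | k * (D * M) < ‖b x - c‖ₑ}.indicator
        (fun _ => (((k : ℝ≥0∞) + 1) * (D * M)) ^ q) := by
    intro k
    ext x
    simp [indicator_apply]
  calc ∫⁻ x in cube a s, ‖b x - c‖ₑ ^ q ∂ν
      ≤ ∫⁻ x in cube a s, ∑' k : ℕ, (if k * (D * M) < ‖b x - c‖ₑ then
        (((k : ℝ≥0∞) + 1) * (D * M)) ^ q else 0) ∂ν :=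
        lintegral_mono fun x => rpow_le_tsum_indicator hq enorm_ne_top hDM0
    _ = ∑' k : ℕ, ∫⁻ x in cube a s, (if k * (D * M) < ‖b x - c‖ₑ then
        (((k : ℝ≥0∞) + 1) * (D * M)) ^ q else 0) ∂ν := by
        refine lintegral_tsum fun k => ?_
        rw [hind]
        exact aemeasurable_const.indicator₀ (hset k)
    _ ≤ ∑' k : ℕ, (((k : ℝ≥0∞) + 1) * (D * M)) ^ q * (γ ^ k * ν (cube a s)) := by
        refine ENNReal.tsum_le_tsum fun k => ?_
        rw [hind, lintegral_indicator_const₀ (hset k)]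
        refine mul_le_mul_right ?_ _
        rw [Measure.restrict_apply₀ (hset k)]
        refine (measure_mono ?_).trans (hJN k a s hs)
        rintro x ⟨hx1, hx2⟩
        exact ⟨hx2, hx1⟩
    _ = _ := by
        rw [hK]
        simp_rw [ENNReal.mul_rpow_of_nonneg _ _ hq.le]
        rw [mul_assoc, mul_assoc, ← ENNReal.tsum_mul_right, ← ENNReal.tsum_mul_left]
        refine tsum_congr fun k => ?_
        ring

/-- The cube of side `2r` around the ball `B(c, r)`. -/
def ballCube (c : Rn n) (r : ℝ) : Set (Rn n) := cube (fun i => c i - r) (2 * r)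

lemma ball_subset_ballCube (c : Rn n) (r : ℝ) : ball c r ⊆ ballCube c r := by
  intro x hx i
  have h1 : |x i - c i| < r := by
    have := PiLp.norm_apply_le (x - c) i
    rw [mem_ball, dist_eq_norm] at hx
    exact (by simpa using this : |x i - c i| ≤ ‖x - c‖).trans_lt hx
  rw [abs_lt] at h1
  constructor <;> linarith

lemma ballCube_subset_ball (c : Rn n) {r : ℝ} (hr : 0 < r) :
    ballCube c r ⊆ ball c ((n + 1) * r) :=
  cube_subset_ball_of_abs_sub_le hr fun x hx i => by
    have := hx i
    rw [abs_le]; constructor <;> linarith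

lemma ballCube_subset_ballCube (c : Rn n) {r R : ℝ} (h : r ≤ R) :
    ballCube c r ⊆ ballCube c R := fun x hx i => by
  have := hx i
  constructor <;> linarith

lemma enorm_average_ballCube_sub_le (hn : 0 < n) {b : Rn n → 𝕜} (hb : LocallyIntegrable b volume)
    {M : ℝ≥0∞} (hM : bmoNorm b ≤ M) (c : Rn n) {r : ℝ} (hr : 0 < r) (k : ℕ) :
    ‖(⨍ y in ballCube c r, b y) - ⨍ y in ballCube c (2 ^ k * r), b y‖ₑ ≤
      k * (2 ^ n * (2 * cubeRatio n * M)) := by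
  induction k with
  | zero => simp
  | succ k ih =>
    have hr1 : 0 < 2 * (2 ^ k * r) := by positivity
    have hr2 : 0 < 2 * (2 ^ (k + 1) * r) := by positivity
    have h0 : volume (ballCube c (2 ^ k * r)) ≠ 0 := volume_cube_ne_zero _ hr1
    have ht : volume (ballCube c (2 ^ k * r)) ≠ ∞ := volume_cube_ne_top _ _
    have hV : volume (ballCube c (2 ^ (k + 1) * r)) =
        2 ^ n * volume (ballCube c (2 ^ k * r)) := by
      rw [ballCube, ballCube, volume_cube, volume_cube, ← mul_pow]
      congr 1
      rw [show 2 * (2 ^ (k + 1) * r) = 2 * (2 * (2 ^ k * r)) by ring,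
        ENNReal.ofReal_mul zero_le_two]
      simp
    set d := ⨍ y in ballCube c (2 ^ k * r), b y
    set e := ⨍ y in ballCube c (2 ^ (k + 1) * r), b y
    have h1 : ‖d - e‖ₑ ≤ 2 ^ n * (2 * cubeRatio n * M) := by
      have := calc ‖d - e‖ₑ * volume (ballCube c (2 ^ k * r))
          ≤ ∫⁻ y in ballCube c (2 ^ k * r), ‖b y - e‖ₑ :=
            enorm_setAverage_sub_le h0 ht (integrableOn_cube hb _ hr1) e
        _ ≤ ∫⁻ y in ballCube c (2 ^ (k + 1) * r), ‖b y - e‖ₑ :=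
            lintegral_mono_set (ballCube_subset_ballCube c (by
              have : 0 < 2 ^ k * r := by positivity
              rw [pow_succ]; linarith))
        _ ≤ 2 * cubeRatio n * M * volume (ballCube c (2 ^ (k + 1) * r)) :=
            lintegral_cube_sub_average_le hn hb hM _ hr2
        _ = 2 ^ n * (2 * cubeRatio n * M) * volume (ballCube c (2 ^ k * r)) := by rw [hV]; ring
      rwa [ENNReal.mul_le_mul_iff_left h0 ht] at this
    set f := ⨍ y in ballCube c r, b y
    calc ‖f - e‖ₑ = ‖(f - d) + (d - e)‖ₑ := by congr 1; ring
      _ ≤ ‖f - d‖ₑ + ‖d - e‖ₑ := enorm_add_le _ _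
      _ ≤ _ := add_le_add ih h1
      _ = _ := by push_cast; ring

lemma add_rpow_le (x y : ℝ≥0∞) {q : ℝ} (hq : 0 < q) :
    (x + y) ^ q ≤ 2 ^ q * (x ^ q + y ^ q) := by
  wlog h : x ≤ y generalizing x y
  · rw [add_comm x, add_comm (x ^ q)]
    exact this y x (le_of_not_ge h)
  calc (x + y) ^ q ≤ (2 * y) ^ q := ENNReal.rpow_le_rpow (by rw [two_mul]; gcongr) hq.le
    _ = 2 ^ q * y ^ q := ENNReal.mul_rpow_of_nonneg _ _ hq.le
    _ ≤ _ := by gcongr; exact le_add_self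

/-- The moments of `b - b_Q` on the dilated balls `2 ^ k B`, where `Q` is the cube around `B`:
the constants grow linearly in `k`. -/
lemma BallComparable.exists_lintegral_ball_rpow_le {ν : Measure (Rn n)} (h : BallComparable ν)
    (hn : 0 < n) {q : ℝ} (hq : 0 < q) (𝕜 : Type*) [RCLike 𝕜] :
    ∃ C : ℝ≥0, ∀ b : Rn n → 𝕜, IsBMO b → ∀ (c : Rn n) (r : ℝ), 0 < r → ∀ k : ℕ,
      ∫⁻ x in ball c (2 ^ k * r), ‖b x - ⨍ y in ballCube c r, b y‖ₑ ^ q ∂ν ≤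
        (C * (k + 1) * bmoNorm b) ^ q * ν (ball c (2 ^ k * r)) := by
  obtain ⟨C₁, hC₁⟩ := h.exists_lintegral_cube_rpow_le hn hq 𝕜
  obtain ⟨C₂, hC₂⟩ := h.exists_doubling hn (t := n + 1) (by simp)
  have hκt := cubeRatio_ne_top (n := n)
  set D : ℝ≥0∞ := 2 ^ n * (2 * cubeRatio n) with hD
  have hDt : D ≠ ∞ := by finiteness
  set A : ℝ≥0∞ := (C₁ : ℝ≥0∞) ^ (1 / q) + D with hA
  have hq' : 0 ≤ 1 / q := by positivity
  have hAt : A ≠ ∞ := ENNReal.add_ne_top.2 ⟨ENNReal.rpow_ne_top_of_nonneg hq' ENNReal.coe_ne_top, hDt⟩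
  set C : ℝ≥0∞ := 2 * 2 ^ (1 / q) * A * (C₂ : ℝ≥0∞) ^ (1 / q) with hC
  have hCt : C ≠ ∞ := ENNReal.mul_ne_top (ENNReal.mul_ne_top (ENNReal.mul_ne_top
    ENNReal.ofNat_ne_top (ENNReal.rpow_ne_top_of_nonneg hq' ENNReal.ofNat_ne_top)) hAt)
    (ENNReal.rpow_ne_top_of_nonneg hq' ENNReal.coe_ne_top)
  have hCq : C ^ q = 2 ^ q * 2 * A ^ q * C₂ := by
    simp only [hC, ENNReal.mul_rpow_of_nonneg _ _ hq.le, ← ENNReal.rpow_mul, one_div,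
      inv_mul_cancel₀ hq.ne', ENNReal.rpow_one]
  refine ⟨C.toNNReal, fun b hb c r hr k => ?_⟩
  rw [ENNReal.coe_toNNReal hCt]
  have hr' : 0 < 2 ^ k * r := by positivity
  have hνt := (h.ball_lt_top c (2 ^ k * r)).ne
  -- The estimate for every `M > ‖b‖`; the case `‖b‖ = 0` then follows by a limit.
  have main : ∀ M : ℝ≥0∞, M ≠ 0 → M ≠ ∞ → bmoNorm b ≤ M →
      ∫⁻ x in ball c (2 ^ k * r), ‖b x - ⨍ y in ballCube c r, b y‖ₑ ^ q ∂ν ≤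
        (C * (k + 1) * M) ^ q * ν (ball c (2 ^ k * r)) := by
    intro M hM0 hMt hM
    set e := ⨍ y in ballCube c r, b y
    set d := ⨍ y in ballCube c (2 ^ k * r), b y
    have h1 : ∫⁻ x in ballCube c (2 ^ k * r), ‖b x - d‖ₑ ^ q ∂ν ≤
        C₁ * M ^ q * ν (ballCube c (2 ^ k * r)) :=
      hC₁ b hb.1 M hM0 hMt hM _ _ (by positivity)
    have h2 : ‖d - e‖ₑ ≤ k * (D * M) := by
      have := enorm_average_ballCube_sub_le hn hb.1 hM c hr k
      rw [← enorm_neg, neg_sub] at this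
      refine this.trans_eq ?_
      rw [hD]; ring
    have h3 : ν (ballCube c (2 ^ k * r)) ≤ C₂ * ν (ball c (2 ^ k * r)) :=
      (measure_mono (ballCube_subset_ball c hr')).trans (hC₂ c _ hr')
    have hk1 : (1 : ℝ≥0∞) ≤ k + 1 := le_add_self
    have h4 : C₁ + (k * D) ^ q ≤ 2 * (A * (k + 1)) ^ q := by
      rw [two_mul]
      refine add_le_add ?_ (ENNReal.rpow_le_rpow ?_ hq.le)
      · calc (C₁ : ℝ≥0∞) = ((C₁ : ℝ≥0∞) ^ (1 / q)) ^ q := by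
              rw [← ENNReal.rpow_mul, one_div, inv_mul_cancel₀ hq.ne', ENNReal.rpow_one]
          _ ≤ _ := ENNReal.rpow_le_rpow (le_self_add.trans (le_mul_of_one_le_right zero_le hk1))
              hq.le
      · rw [mul_comm]
        exact mul_le_mul' le_add_self le_self_add
    calc ∫⁻ x in ball c (2 ^ k * r), ‖b x - e‖ₑ ^ q ∂ν
        ≤ ∫⁻ x in ballCube c (2 ^ k * r), ‖b x - e‖ₑ ^ q ∂ν :=
          lintegral_mono_set (ball_subset_ballCube _ _)
      _ ≤ ∫⁻ x in ballCube c (2 ^ k * r), 2 ^ q * (‖b x - d‖ₑ ^ q + ‖d - e‖ₑ ^ q) ∂ν := by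
          refine lintegral_mono fun x => le_trans ?_ (add_rpow_le _ _ hq)
          refine ENNReal.rpow_le_rpow ?_ hq.le
          calc ‖b x - e‖ₑ = ‖(b x - d) + (d - e)‖ₑ := by congr 1; ring
            _ ≤ _ := enorm_add_le _ _
      _ = 2 ^ q * ((∫⁻ x in ballCube c (2 ^ k * r), ‖b x - d‖ₑ ^ q ∂ν) +
            ‖d - e‖ₑ ^ q * ν (ballCube c (2 ^ k * r))) := by
          rw [lintegral_const_mul' _ _ (ENNReal.rpow_ne_top_of_nonneg hq.le ENNReal.ofNat_ne_top),
            lintegral_add_right _ measurable_const]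
          simp
      _ ≤ 2 ^ q * (C₁ * M ^ q * ν (ballCube c (2 ^ k * r)) +
            (k * (D * M)) ^ q * ν (ballCube c (2 ^ k * r))) := by gcongr
      _ = 2 ^ q * (C₁ + (k * D) ^ q) * M ^ q * ν (ballCube c (2 ^ k * r)) := by
          rw [← mul_assoc (k : ℝ≥0∞), ENNReal.mul_rpow_of_nonneg (k * D) M hq.le]
          ring
      _ ≤ 2 ^ q * (2 * (A * (k + 1)) ^ q) * M ^ q * (C₂ * ν (ball c (2 ^ k * r))) := by gcongr
      _ = _ := by
          rw [ENNReal.mul_rpow_of_nonneg (C * (k + 1)) M hq.le,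
            ENNReal.mul_rpow_of_nonneg C _ hq.le, hCq, ENNReal.mul_rpow_of_nonneg A _ hq.le]
          ring
  have hcont : Filter.Tendsto (fun ε : ℝ≥0∞ =>
      (C * (k + 1) * (bmoNorm b + ε)) ^ q * ν (ball c (2 ^ k * r))) (nhdsWithin 0 (Ioi 0))
      (nhds ((C * (k + 1) * (bmoNorm b + 0)) ^ q * ν (ball c (2 ^ k * r)))) := by
    refine ENNReal.Tendsto.mul_const ?_ (Or.inr hνt)
    refine ((ENNReal.continuous_rpow_const).tendsto _).comp ?_
    refine ENNReal.Tendsto.const_mul ?_ (Or.inr (by finiteness))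
    exact tendsto_const_nhds.add (Filter.tendsto_id.mono_left nhdsWithin_le_nhds)
  rw [add_zero] at hcont
  refine ge_of_tendsto hcont ?_
  filter_upwards [self_mem_nhdsWithin, mem_nhdsWithin_of_mem_nhds (Iio_mem_nhds one_pos)]
    with ε hε hε1
  refine main _ ?_ (ENNReal.add_ne_top.2 ⟨hb.2.ne, (hε1.trans ENNReal.one_lt_top).ne⟩) le_self_add
  exact (pos_iff_ne_zero.1 (hε.trans_le le_add_self))

end BMO

end JohnNirenberg

section Commutator

variable {n m : ℕ} {𝕜 : Type*} [RCLike 𝕜]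

/-! ### Expansion of the iterated commutator -/

/-- Full expansion of `T` at a sum of two tuples: `S` is the set of entries taken from `f₁`. -/
lemma IsMSublinear.norm_add_le_sum {T : (Fin m → Rn n → 𝕜) → Rn n → 𝕜}
    {D : Fin m → Set (Rn n → 𝕜)} (hT : IsMSublinear T D) {f₀ f₁ : Fin m → Rn n → 𝕜}
    (h₀ : ∀ i, f₀ i ∈ D i) (h₁ : ∀ i, f₁ i ∈ D i) (h : ∀ i, f₀ i + f₁ i ∈ D i) (x : Rn n) :
    ‖T (fun i => f₀ i + f₁ i) x‖ ≤
      ∑ S : Finset (Fin m), ‖T (fun i => if i ∈ S then f₁ i else f₀ i) x‖ := by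
  have key : ∀ U : Finset (Fin m), ‖T (fun i => f₀ i + f₁ i) x‖ ≤
      ∑ S ∈ U.powerset,
        ‖T (fun i => if i ∈ S then f₁ i else if i ∈ U then f₀ i else f₀ i + f₁ i) x‖ := by
    intro U
    induction U using Finset.induction_on with
    | empty => simp
    | insert a U ha ih =>
      refine ih.trans ?_
      rw [Finset.sum_powerset_insert ha, ← Finset.sum_add_distrib]
      refine Finset.sum_le_sum fun S hS => ?_
      have haS : a ∉ S := fun h' => ha (Finset.mem_powerset.1 hS h')
      set F : Fin m → Rn n → 𝕜 := fun i =>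
        if i ∈ S then f₁ i else if i ∈ insert a U then f₀ i else f₀ i + f₁ i with hF
      have hFD : ∀ i, F i ∈ D i := by
        intro i
        simp only [hF]
        split_ifs
        exacts [h₁ i, h₀ i, h i]
      have hFa : F a = f₀ a := by simp [hF, haS]
      have e1 : Function.update F a (F a + f₁ a) =
          fun i => if i ∈ S then f₁ i else if i ∈ U then f₀ i else f₀ i + f₁ i := by
        ext i y
        by_cases hi : i = a
        · subst hi; simp [hFa, haS, ha]
        · simp [hF, hi]
      have e2 : Function.update F a (f₁ a) = fun i => if i ∈ insert a S then f₁ i else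
          if i ∈ insert a U then f₀ i else f₀ i + f₁ i := by
        ext i y
        by_cases hi : i = a
        · subst hi; simp
        · simp [hF, hi]
      have := hT.add_le F hFD a (f₁ a) (h₁ a) x
      rwa [e1, e2] at this
  simpa using key Finset.univ

lemma IsMSublinear.norm_smul_eq {T : (Fin m → Rn n → 𝕜) → Rn n → 𝕜}
    {D : Fin m → Set (Rn n → 𝕜)} (hT : IsMSublinear T D) {f : Fin m → Rn n → 𝕜} (a : Fin m → 𝕜)
    (h : ∀ i, f i ∈ D i) (ha : ∀ i, a i • f i ∈ D i) (Q : Finset (Fin m)) (x : Rn n) :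
    ‖T (fun i => if i ∈ Q then a i • f i else f i) x‖ = (∏ i ∈ Q, ‖a i‖) * ‖T f x‖ := by
  induction Q using Finset.induction_on with
  | empty => simp
  | insert k Q hk ih =>
    set F : Fin m → Rn n → 𝕜 := fun i => if i ∈ Q then a i • f i else f i with hF
    have hFD : ∀ i, F i ∈ D i := by
      intro i
      simp only [hF]
      split_ifs
      exacts [ha i, h i]
    have e : (fun i => if i ∈ insert k Q then a i • f i else f i) =
        Function.update F k (a k • F k) := by
      ext i y
      by_cases hi : i = k
      · subst hi; simp [hF, hk]
      · simp [hF, hi]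
    rw [e, hT.smul F hFD k (a k) x, ih, Finset.prod_insert hk, mul_assoc]

section Domain

variable {X : Set (Rn n → 𝕜)} {b : Rn n → 𝕜}

/-- Closure of a set of functions under multiplication by scalars and by indicators. -/
structure IsTruncClosed (X : Set (Rn n → 𝕜)) : Prop where
  smul : ∀ f ∈ X, ∀ a : 𝕜, a • f ∈ X
  indicator : ∀ f ∈ X, ∀ E : Set (Rn n), MeasurableSet E → E.indicator f ∈ X

lemma IsTruncClosed.commDomain (hX : IsTruncClosed X) : IsTruncClosed (commDomain b X) where
  smul := by
    rintro _ ⟨f, hf, g, hg, rfl⟩ a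
    refine ⟨a • f, hX.smul f hf a, a • g, hX.smul g hg a, ?_⟩
    ext y; simp; ring
  indicator := by
    rintro _ ⟨f, hf, g, hg, rfl⟩ E hE
    refine ⟨_, hX.indicator f hf E hE, _, hX.indicator g hg E hE, ?_⟩
    ext y
    by_cases hy : y ∈ E <;> simp [hy]

lemma IsTruncClosed.subset_commDomain (hX : IsTruncClosed X) {f : Rn n → 𝕜} (hf : f ∈ X) :
    f ∈ _root_.commDomain b X :=
  ⟨f, hf, (0 : 𝕜) • f, hX.smul f hf 0, by simp⟩

lemma IsTruncClosed.sub_mul_mem_commDomain (hX : IsTruncClosed X) {f : Rn n → 𝕜} (hf : f ∈ X)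
    (a : 𝕜) : (fun y => (a - b y) * f y) ∈ _root_.commDomain b X :=
  ⟨a • f, hX.smul f hf a, (-1 : 𝕜) • f, hX.smul f hf (-1), by ext y; simp; ring⟩

lemma morreyNorm_smul {p : ℝ} {φ : Rn n → ℝ → ℝ≥0} {x₀ : Rn n}
    {w : Rn n → ℝ} (f : Rn n → 𝕜) (a : 𝕜) :
    morreyNorm p φ x₀ w (a • f) = ‖a‖ₑ * morreyNorm p φ x₀ w f := by
  simp only [morreyNorm, eLpNorm_const_smul, ENNReal.mul_iSup]
  refine iSup_congr fun r => iSup_congr fun _ => ?_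
  ring

lemma isTruncClosed_normSpace_morreyNorm (p : ℝ) (φ : Rn n → ℝ → ℝ≥0) (x₀ : Rn n)
    (w : Rn n → ℝ) :
    IsTruncClosed (normSpace (𝕜 := 𝕜) (morreyNorm p φ x₀ w)) where
  smul f hf a := ⟨hf.1.const_smul a, by
    rw [morreyNorm_smul]; exact ENNReal.mul_lt_top enorm_lt_top hf.2⟩
  indicator f hf E hE := ⟨hf.1.indicator hE, by
    refine lt_of_le_of_lt (iSup₂_mono fun r _ => ?_) hf.2
    gcongr
    exact eLpNorm_indicator_le f⟩

end Domain

/-- The tuple with entries `f_i` for `i ∈ Q` and `(l_i - b_i) f_i` for `i ∉ Q`, which arises from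
`(b_i(x) - b_i) f_i = (b_i(x) - l_i) f_i + (l_i - b_i) f_i`. -/
def commTuple (b : Fin m → Rn n → 𝕜) (l : Fin m → 𝕜) (Q : Finset (Fin m))
    (f : Fin m → Rn n → 𝕜) : Fin m → Rn n → 𝕜 :=
  fun i => if i ∈ Q then f i else fun y => (l i - b i y) * f i y

lemma commTuple_mem {X : Fin m → Set (Rn n → 𝕜)} (hX : ∀ i, IsTruncClosed (X i))
    {b f : Fin m → Rn n → 𝕜} (hf : ∀ i, f i ∈ X i) (l : Fin m → 𝕜) (Q : Finset (Fin m))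
    (i : Fin m) : commTuple b l Q f i ∈ commDomain (b i) (X i) := by
  unfold commTuple
  split_ifs
  · exact (hX i).subset_commDomain (hf i)
  · exact (hX i).sub_mul_mem_commDomain (hf i) _

lemma truncTuple_mem {D : Fin m → Set (Rn n → 𝕜)} (hD : ∀ i, IsTruncClosed (D i))
    {f : Fin m → Rn n → 𝕜} (hf : ∀ i, f i ∈ D i) (S : Finset (Fin m)) (c : Rn n) (r : ℝ)
    (i : Fin m) : truncTuple S c r f i ∈ D i := by
  unfold truncTuple
  split_ifs
  · exact (hD i).indicator _ (hf i) _ measurableSet_ball.compl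
  · exact (hD i).indicator _ (hf i) _ measurableSet_ball

/-- The pointwise expansion of the iterated commutator. The terms other than the first are values
of `T` at truncated tuples that do not depend on `x`, so that the local size condition applies. -/
lemma IsMSublinear.norm_iteratedCommutator_le {T : (Fin m → Rn n → 𝕜) → Rn n → 𝕜}
    {b : Fin m → Rn n → 𝕜} {X : Fin m → Set (Rn n → 𝕜)} (hX : ∀ i, IsTruncClosed (X i))
    (hT : IsMSublinear T (fun i => commDomain (b i) (X i))) {f : Fin m → Rn n → 𝕜}
    (hf : ∀ i, f i ∈ X i) (l : Fin m → 𝕜) (c : Rn n) (r : ℝ) (x : Rn n) :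
    ‖iteratedCommutator T b f x‖ ≤ ‖iteratedCommutator T b (truncTuple ∅ c r f) x‖ +
      ∑ S ∈ (Finset.univ : Finset (Finset (Fin m))).erase ∅, ∑ Q : Finset (Fin m),
        (∏ i ∈ Q, ‖b i x - l i‖) * ‖T (truncTuple S c r (commTuple b l Q f)) x‖ := by
  have hD : ∀ i, IsTruncClosed (commDomain (b i) (X i)) := fun i => (hX i).commDomain
  set h : Fin m → Rn n → 𝕜 := fun i y => (b i x - b i y) * f i y with hh
  have hhD : ∀ i, h i ∈ commDomain (b i) (X i) := fun i =>
    (hX i).sub_mul_mem_commDomain (hf i) (b i x)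
  have e1 : (fun i => (ball c (2 * r)).indicator (h i) + (ball c (2 * r))ᶜ.indicator (h i)) = h :=
    funext fun i => indicator_self_add_compl _ _
  have step1 := hT.norm_add_le_sum (f₀ := fun i => (ball c (2 * r)).indicator (h i))
    (f₁ := fun i => (ball c (2 * r))ᶜ.indicator (h i))
    (fun i => (hD i).indicator _ (hhD i) _ measurableSet_ball)
    (fun i => (hD i).indicator _ (hhD i) _ measurableSet_ball.compl)
    (fun i => by rw [indicator_self_add_compl]; exact hhD i) x
  rw [e1, ← Finset.add_sum_erase _ _ (Finset.mem_univ ∅)] at step1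
  refine step1.trans (add_le_add (le_of_eq ?_) (Finset.sum_le_sum fun S _ => ?_))
  · congr 2
    ext i y
    by_cases hy : y ∈ ball c (2 * r)
    · simp [truncTuple, hy, hh]
    · simp [truncTuple, hy]
  · have hg : ∀ Q, ∀ i, truncTuple S c r (commTuple b l Q f) i ∈ commDomain (b i) (X i) :=
      fun Q => truncTuple_mem hD (commTuple_mem hX hf l Q) S c r
    set g₁ : Fin m → Rn n → 𝕜 := truncTuple S c r f with hg₁
    set g₀ : Fin m → Rn n → 𝕜 := truncTuple S c r (commTuple b l ∅ f) with hg₀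
    have hg₁D : ∀ i, g₁ i ∈ commDomain (b i) (X i) :=
      truncTuple_mem hD (fun i => (hX i).subset_commDomain (hf i)) S c r
    have hsplit : (fun i => g₀ i + (b i x - l i) • g₁ i) =
        fun i => if i ∈ S then (ball c (2 * r))ᶜ.indicator (h i)
          else (ball c (2 * r)).indicator (h i) := by
      ext i y
      by_cases hi : i ∈ S <;> by_cases hy : y ∈ ball c (2 * r) <;>
        simp [hg₀, hg₁, truncTuple, commTuple, hh, hi, hy] <;> ring
    have step2 := hT.norm_add_le_sum (f₀ := g₀) (f₁ := fun i => (b i x - l i) • g₁ i) (hg ∅)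
      (fun i => (hD i).smul _ (hg₁D i) _)
      (fun i => by
        rw [congrFun hsplit i]
        split_ifs
        exacts [(hD i).indicator _ (hhD i) _ measurableSet_ball.compl,
          (hD i).indicator _ (hhD i) _ measurableSet_ball]) x
    rw [hsplit] at step2
    refine step2.trans_eq (Finset.sum_congr rfl fun Q _ => ?_)
    rw [← hT.norm_smul_eq (fun i => b i x - l i) (hg Q) (fun i => (hD i).smul _ (hg Q i) _) Q x]
    congr 2
    ext i y
    by_cases hi : i ∈ Q <;> simp [hi, hg₀, hg₁, truncTuple, commTuple]

/-! ### Mean values of the entries -/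

/-- Hölder's inequality for `u |f|`, splitting `1 = w ^ (-1 / p) * w ^ (1 / p)`. -/
lemma lintegral_mul_enorm_le {p : ℝ} (hp : 1 < p) {w : Rn n → ℝ} (hw : IsWeight w)
    {u : Rn n → ℝ≥0∞} (hu : AEMeasurable u volume) {f : Rn n → 𝕜}
    (hf : AEStronglyMeasurable f volume) (c : Rn n) (R : ℝ) :
    ∫⁻ x in ball c R, u x * ‖f x‖ₑ ≤
      (∫⁻ x in ball c R, u x ^ p.conjExponent ∂(volume.withDensity (dualWeight p w))) ^
        (1 / p.conjExponent) *
        eLpNorm f (ENNReal.ofReal p) ((wMeasure w).restrict (ball c R)) := by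
  have hpq := Real.HolderConjugate.conjExponent hp
  have hp0 : 0 < p := hpq.pos
  have hq0 : 0 < p.conjExponent := hpq.symm.pos
  set W : Rn n → ℝ≥0∞ := fun x => ENNReal.ofReal (w x) with hW
  have hWm : AEMeasurable W volume := hw.aemeasurable_ofReal
  have hfm : AEMeasurable (fun x => ‖f x‖ₑ) volume := hf.enorm
  have h1 : ∫⁻ x in ball c R, u x * ‖f x‖ₑ =
      ∫⁻ x in ball c R, ((fun x => u x * W x ^ (-(1 / p))) *
        (fun x => W x ^ (1 / p) * ‖f x‖ₑ)) x := by
    refine lintegral_congr_ae (ae_restrict_of_ae ?_)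
    filter_upwards [hw.ae_ofReal] with x hx
    simp only [Pi.mul_apply]
    calc u x * ‖f x‖ₑ = u x * ‖f x‖ₑ * (W x ^ (1 / p) * W x ^ (-(1 / p))) := by
          rw [ENNReal.rpow_mul_rpow_neg_eq_one hx ENNReal.ofReal_ne_top, mul_one]
      _ = _ := by ring
  have h2 : ∫⁻ x in ball c R, (u x * W x ^ (-(1 / p))) ^ p.conjExponent =
      ∫⁻ x in ball c R, u x ^ p.conjExponent ∂(volume.withDensity (dualWeight p w)) := by
    rw [restrict_withDensity measurableSet_ball, lintegral_withDensity_eq_lintegral_mul₀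
      (hw.aemeasurable_dualWeight p).restrict (hu.pow_const _).restrict]
    refine lintegral_congr fun x => ?_
    rw [Pi.mul_apply, ENNReal.mul_rpow_of_nonneg _ _ hq0.le, ← ENNReal.rpow_mul, mul_comm,
      dualWeight, one_sub_conjExponent hp]
    congr 2
    ring
  have h3 : (∫⁻ x in ball c R, (W x ^ (1 / p) * ‖f x‖ₑ) ^ p) ^ (1 / p) =
      eLpNorm f (ENNReal.ofReal p) ((wMeasure w).restrict (ball c R)) := by
    rw [eLpNorm_eq_lintegral_rpow_enorm_toReal (by simpa using hp0) ENNReal.ofReal_ne_top,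
      ENNReal.toReal_ofReal hp0.le, wMeasure, restrict_withDensity measurableSet_ball,
      lintegral_withDensity_eq_lintegral_mul₀ hWm.restrict (hfm.pow_const _).restrict]
    congr 1
    refine lintegral_congr fun x => ?_
    rw [Pi.mul_apply, ENNReal.mul_rpow_of_nonneg _ _ hp0.le, ← ENNReal.rpow_mul, one_div,
      inv_mul_cancel₀ hp0.ne', ENNReal.rpow_one]
  rw [h1, ← h2, ← h3]
  exact ENNReal.lintegral_mul_le_Lp_mul_Lq _ hpq.symm
    (hu.mul (hWm.pow_const _)).restrict ((hWm.pow_const _).mul hfm).restrict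

/-- The mean values in the local size condition, for the entries `f_i` and `(l_i - b_i) f_i`. -/
lemma IsMultiAP.exists_prod_ballMean_commTuple_le {p : ℝ} {P : Fin m → ℝ}
    {w : Fin m → Rn n → ℝ} (h : IsMultiAP p P w) (hn : 0 < n) (hm : 0 < m)
    (hP : ∀ i, 1 < P i) (hp : 1 / p = ∑ i, 1 / P i) (hA : ∀ i, IsAInfty (w i))
    (𝕜 : Type*) [RCLike 𝕜] :
    ∃ C : ℝ≥0, ∀ b f : Fin m → Rn n → 𝕜, (∀ i, IsBMO (b i)) →
      (∀ i, AEStronglyMeasurable (f i) volume) → ∀ (c : Rn n) (r : ℝ), 0 < r →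
      ∀ (k : ℕ) (Q : Finset (Fin m)),
      ∏ i, ballMean c (2 ^ k * r)
        (fun y => ‖commTuple b (fun i => ⨍ y in ballCube c r, b i y) Q f i y‖ₑ) ≤
      C * (∏ i, if i ∈ Q then 1 else bmoNorm (b i)) * ((k + 1) ^ m *
        ((∏ i, eLpNorm (f i) (ENNReal.ofReal (P i))
          ((wMeasure (w i)).restrict (ball c (2 ^ k * r)))) /
          ∏ i, wMeasure (w i) (ball c (2 ^ k * r)) ^ (1 / P i))) := by
  have hw := fun i => h.1 i
  obtain ⟨C₀, hC₀⟩ := h.exists_prod_mul_prod_le hm hP hp hA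
  have hq : ∀ i, 0 < (P i).conjExponent := fun i => conjExponent_pos (hP i)
  have hP0 : ∀ i, 0 < P i := fun i => one_pos.trans (hP i)
  choose C hC using fun i =>
    (h.ballComparable_dualWeight hm hP hp i).exists_lintegral_ball_rpow_le hn (hq i) 𝕜
  refine ⟨C₀ * ∏ i, max (C i) 1, fun b f hb hf c r hr k Q => ?_⟩
  set l : Fin m → 𝕜 := fun i => ⨍ y in ballCube c r, b i y with hl
  have hR : 0 < 2 ^ k * r := by positivity
  have hV0 := volume_ball_pos c hR
  have hVt := volume_ball_ne_top c (2 ^ k * r)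
  have hC₀' := hC₀ c _ hR
  set B := ball c (2 ^ k * r) with hB
  set σ : Fin m → ℝ≥0∞ := fun i => ∫⁻ x in B, dualWeight (P i) (w i) x with hσ
  have hσB : ∀ i, volume.withDensity (dualWeight (P i) (w i)) B = σ i := fun i =>
    withDensity_apply _ measurableSet_ball
  set L : Fin m → ℝ≥0∞ := fun i => eLpNorm (f i) (ENNReal.ofReal (P i))
    ((wMeasure (w i)).restrict B) with hL
  set β : Fin m → ℝ≥0∞ := fun i => if i ∈ Q then 1 else bmoNorm (b i) with hβ
  set W : ℝ≥0∞ := ∏ i, wMeasure (w i) B ^ (1 / P i) with hW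
  have hW0 : W ≠ 0 := Finset.prod_ne_zero_iff.2 fun i _ => by
    rw [ne_eq, ENNReal.rpow_eq_zero_iff_of_pos (one_div_pos.2 (hP0 i))]
    exact (hw i).wMeasure_ball_ne_zero c hR
  have hWt : W ≠ ∞ := ENNReal.prod_ne_top fun i _ =>
    ENNReal.rpow_ne_top_of_nonneg (one_div_pos.2 (hP0 i)).le ((hw i).wMeasure_ball_lt_top _ _).ne
  have hk1 : (1 : ℝ≥0∞) ≤ k + 1 := le_add_self
  have hmean : ∀ i, ballMean c (2 ^ k * r) (fun y => ‖commTuple b l Q f i y‖ₑ) ≤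
      (volume B)⁻¹ * ((max (C i) 1 : ℝ≥0) * (k + 1) * β i * σ i ^ (1 / (P i).conjExponent) * L i) := by
    intro i
    refine mul_le_mul_right ?_ _
    by_cases hi : i ∈ Q
    · have h1 := lintegral_mul_enorm_le (hP i) (hw i) (u := fun _ => 1) aemeasurable_const (hf i)
        c (2 ^ k * r)
      simp only [one_mul, ENNReal.one_rpow, lintegral_one, Measure.restrict_apply_univ] at h1
      rw [hσB] at h1
      have e : commTuple b l Q f i = f i := by simp [commTuple, hi]
      have e2 : β i = 1 := by simp [hβ, hi]
      rw [e, e2, mul_one]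
      refine h1.trans ?_
      gcongr ?_ * _
      refine le_mul_of_one_le_left zero_le ?_
      exact one_le_mul_of_one_le_of_one_le (by exact_mod_cast le_max_right _ _) hk1
    · have hbm : AEMeasurable (fun y => ‖b i y - l i‖ₑ) volume :=
        ((hb i).1.aestronglyMeasurable.sub aestronglyMeasurable_const).enorm
      have h1 := lintegral_mul_enorm_le (hP i) (hw i) hbm (hf i) c (2 ^ k * r)
      have e : ∀ y, ‖commTuple b l Q f i y‖ₑ = ‖b i y - l i‖ₑ * ‖f i y‖ₑ := by
        intro y
        simp only [commTuple, hi, if_false]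
        rw [enorm_mul, ← enorm_neg (b i y - l i), neg_sub]
      have e2 : β i = bmoNorm (b i) := by simp [hβ, hi]
      simp only [e, e2]
      refine h1.trans ?_
      gcongr ?_ * _
      calc _ ≤ ((C i * (k + 1) * bmoNorm (b i)) ^ (P i).conjExponent * σ i) ^
            (1 / (P i).conjExponent) := by
            refine ENNReal.rpow_le_rpow ?_ (one_div_pos.2 (hq i)).le
            rw [← hσB]
            exact hC i (b i) (hb i) c r hr k
        _ = C i * (k + 1) * bmoNorm (b i) * σ i ^ (1 / (P i).conjExponent) := by
            rw [ENNReal.mul_rpow_of_nonneg _ _ (one_div_pos.2 (hq i)).le, ← ENNReal.rpow_mul,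
              mul_one_div_cancel (hq i).ne', ENNReal.rpow_one]
        _ ≤ _ := by
            gcongr
            exact le_max_left _ _
  have hσW : (volume B)⁻¹ ^ m * ∏ i, σ i ^ (1 / (P i).conjExponent) ≤ C₀ / W := by
    rw [ENNReal.le_div_iff_mul_le (Or.inl hW0) (Or.inl hWt), mul_assoc]
    calc _ ≤ (volume B)⁻¹ ^ m * (C₀ * volume B ^ (m : ℝ)) := by gcongr
      _ = C₀ * ((volume B)⁻¹ * volume B) ^ m := by rw [ENNReal.rpow_natCast, mul_pow]; ring
      _ = C₀ := by rw [ENNReal.inv_mul_cancel hV0 hVt, one_pow, mul_one]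
  calc _ ≤ ∏ i, ((volume B)⁻¹ *
        ((max (C i) 1 : ℝ≥0) * (k + 1) * β i * σ i ^ (1 / (P i).conjExponent) * L i)) :=
        Finset.prod_le_prod' fun i _ => hmean i
    _ = ((volume B)⁻¹ ^ m * ∏ i, σ i ^ (1 / (P i).conjExponent)) *
        ((∏ i, ((max (C i) 1 : ℝ≥0) : ℝ≥0∞)) * (∏ i, β i) * ((k + 1) ^ m * ∏ i, L i)) := by
        simp only [Finset.prod_mul_distrib, Finset.prod_const, Finset.card_univ, Fintype.card_fin]
        ring
    _ ≤ C₀ / W * ((∏ i, ((max (C i) 1 : ℝ≥0) : ℝ≥0∞)) * (∏ i, β i) *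
        ((k + 1) ^ m * ∏ i, L i)) := by gcongr
    _ = _ := by
        rw [ENNReal.coe_mul, ENNReal.ofNNReal_finsetProd, div_eq_mul_inv, div_eq_mul_inv]
        ring

/-! ### Summation over dyadic balls -/

lemma sum_rpow_le {ι : Type*} (K : Finset ι) (a : ι → ℝ≥0∞) {q : ℝ} (hq : 0 < q) :
    (∑ i ∈ K, a i) ^ q ≤ (K.card : ℝ≥0∞) ^ q * ∑ i ∈ K, a i ^ q := by
  rcases K.eq_empty_or_nonempty with rfl | hK
  · simp [ENNReal.zero_rpow_of_pos hq]
  obtain ⟨j, hj, hmax⟩ := K.exists_max_image a hK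
  calc (∑ i ∈ K, a i) ^ q ≤ ((K.card : ℝ≥0∞) * a j) ^ q := by
        refine ENNReal.rpow_le_rpow ?_ hq.le
        rw [← nsmul_eq_mul]
        exact Finset.sum_le_card_nsmul K a (a j) hmax
    _ = (K.card : ℝ≥0∞) ^ q * a j ^ q := ENNReal.mul_rpow_of_nonneg _ _ hq.le
    _ ≤ _ := by
        gcongr
        exact Finset.single_le_sum (f := fun i => a i ^ q) (fun i _ => zero_le) hj

/-- Products of oscillations of functions of bounded mean oscillation in `L ^ q` of a ball: the
moments of order `q m` of the factors and Hölder's inequality. -/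
lemma BallComparable.exists_lintegral_prod_rpow_le {ν : Measure (Rn n)} (h : BallComparable ν)
    (hn : 0 < n) (hm : 0 < m) {q : ℝ} (hq : 0 < q) (𝕜 : Type*) [RCLike 𝕜] :
    ∃ C : ℝ≥0, ∀ b : Fin m → Rn n → 𝕜, (∀ i, IsBMO (b i)) → ∀ (c : Rn n) (r : ℝ), 0 < r →
      ∀ Q : Finset (Fin m),
      ∫⁻ x in ball c r, (∏ i ∈ Q, ‖b i x - ⨍ y in ballCube c r, b i y‖ₑ) ^ q ∂ν ≤
        (C * ∏ i, if i ∈ Q then bmoNorm (b i) else 1) ^ q * ν (ball c r) := by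
  have hm' : (0 : ℝ) < m := by exact_mod_cast hm
  obtain ⟨C, hC⟩ := h.exists_lintegral_ball_rpow_le hn (q := q * m) (by positivity) 𝕜
  refine ⟨max C 1 ^ m, fun b hb c r hr Q => ?_⟩
  set l : Fin m → 𝕜 := fun i => ⨍ y in ballCube c r, b i y with hl
  have hbm : ∀ i, AEMeasurable (fun x => ‖b i x - l i‖ₑ) ν := fun i =>
    (((hb i).1.aestronglyMeasurable.mono_ac h.ac).sub aestronglyMeasurable_const).enorm
  set β : Fin m → ℝ≥0∞ := fun i => if i ∈ Q then bmoNorm (b i) else 1 with hβ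
  set g : Fin m → Rn n → ℝ≥0∞ := fun i x => (if i ∈ Q then ‖b i x - l i‖ₑ else 1) ^ (q * m) with hg
  have hgm : ∀ i, AEMeasurable (g i) (ν.restrict (ball c r)) := by
    intro i
    simp only [hg]
    split_ifs
    · exact ((hbm i).pow_const _).restrict
    · exact aemeasurable_const
  have h1 : ∀ x, (∏ i ∈ Q, ‖b i x - l i‖ₑ) ^ q = ∏ i, g i x ^ (1 / (m : ℝ)) := by
    intro x
    simp only [hg, ← ENNReal.rpow_mul, mul_assoc, mul_one_div_cancel hm'.ne', mul_one]
    rw [ENNReal.prod_rpow_of_nonneg hq.le, Finset.prod_ite_mem, Finset.univ_inter]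
  have h2 : ∀ i, ∫⁻ x in ball c r, g i x ∂ν ≤
      (max C 1 * β i) ^ (q * m) * ν (ball c r) := by
    intro i
    by_cases hi : i ∈ Q
    · simp only [hg, hβ, hi, if_true]
      have := hC (b i) (hb i) c r hr 0
      rw [pow_zero, one_mul] at this
      refine this.trans ?_
      gcongr
      simp
    · simp only [hg, hβ, hi, if_false, ENNReal.one_rpow, lintegral_one,
        Measure.restrict_apply_univ, mul_one]
      refine le_mul_of_one_le_left zero_le ?_
      refine ENNReal.one_le_rpow ?_ (by positivity)
      exact le_max_right (C : ℝ≥0∞) 1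
  calc _ = ∫⁻ x in ball c r, ∏ i, g i x ^ (1 / (m : ℝ)) ∂ν := lintegral_congr fun x => h1 x
    _ ≤ ∏ i, (∫⁻ x in ball c r, g i x ∂ν) ^ (1 / (m : ℝ)) :=
        ENNReal.lintegral_prod_norm_pow_le _ (fun i _ => hgm i)
          (by simp [hm'.ne']) (fun i _ => by positivity)
    _ ≤ ∏ i, ((max C 1 * β i) ^ (q * m) * ν (ball c r)) ^ (1 / (m : ℝ)) :=
        Finset.prod_le_prod' fun i _ => ENNReal.rpow_le_rpow (h2 i) (by positivity)
    _ = ∏ i, ((max C 1 * β i) ^ q * ν (ball c r) ^ (1 / (m : ℝ))) := by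
        refine Finset.prod_congr rfl fun i _ => ?_
        rw [ENNReal.mul_rpow_of_nonneg _ _ (by positivity), ← ENNReal.rpow_mul, mul_assoc,
          mul_one_div_cancel hm'.ne', mul_one]
    _ = _ := by
        rw [Finset.prod_mul_distrib, ENNReal.prod_rpow_of_nonneg hq.le, Finset.prod_mul_distrib]
        simp only [Finset.prod_const, Finset.card_univ, Fintype.card_fin]
        rw [← ENNReal.rpow_natCast (ν (ball c r) ^ (1 / (m : ℝ))), ← ENNReal.rpow_mul,
          one_div_mul_cancel hm'.ne', ENNReal.rpow_one]
        simp

/-- The term `a j` is charged to the dyadic interval `(2 ^ (j + 2) r, 2 ^ (j + 3) r]`, which has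
mass at least `1 / 2` for `dt / t`. -/
lemma tsum_le_lintegral_Ioi {r : ℝ} (hr : 0 < r) (a : ℕ → ℝ≥0∞) (G : ℝ → ℝ≥0∞)
    (h : ∀ j : ℕ, ∀ t ∈ Ioc (2 ^ (j + 2) * r) (2 ^ (j + 3) * r), a j ≤ G t) :
    ∑' j, a j ≤ 2 * ∫⁻ t in Ioi r, G t * ENNReal.ofReal (1 / t) := by
  have hdisj : Pairwise (Function.onFun Disjoint
      fun j : ℕ => Ioc (2 ^ (j + 2) * r) (2 ^ (j + 3) * r)) := by
    have hmono : Monotone fun j : ℕ => 2 ^ (j + 2) * r := by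
      intro i j hij
      have : (2 : ℝ) ^ (i + 2) ≤ 2 ^ (j + 2) := pow_le_pow_right₀ one_le_two (by omega)
      exact mul_le_mul_of_nonneg_right this hr.le
    exact hmono.pairwise_disjoint_on_Ioc_succ
  have hterm : ∀ j : ℕ, a j ≤ 2 * ∫⁻ t in Ioc (2 ^ (j + 2) * r) (2 ^ (j + 3) * r),
      G t * ENNReal.ofReal (1 / t) := by
    intro j
    have hR : 0 < 2 ^ (j + 2) * r := by positivity
    set R := 2 ^ (j + 2) * r
    have hR2 : 2 ^ (j + 3) * r = 2 * R := by simp only [R, pow_succ]; ring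
    rw [hR2]
    calc a j = 2 * (a j * ENNReal.ofReal (1 / (2 * R)) * ENNReal.ofReal R) := by
          rw [mul_assoc, ← ENNReal.ofReal_mul (by positivity),
            show 1 / (2 * R) * R = 1 / 2 by field_simp, mul_left_comm,
            ← ENNReal.ofReal_ofNat, ← ENNReal.ofReal_mul zero_le_two]
          norm_num
      _ = 2 * ∫⁻ t in Ioc R (2 * R), a j * ENNReal.ofReal (1 / (2 * R)) := by
          rw [setLIntegral_const, Real.volume_Ioc]
          congr 3
          ring
      _ ≤ _ := by
          refine mul_le_mul_right (setLIntegral_mono' measurableSet_Ioc fun t ht => ?_) _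
          refine mul_le_mul' (h j t (by rwa [hR2])) (ENNReal.ofReal_le_ofReal ?_)
          exact one_div_le_one_div_of_le (hR.trans ht.1) ht.2
  calc ∑' j, a j ≤ ∑' j : ℕ, 2 * ∫⁻ t in Ioc (2 ^ (j + 2) * r) (2 ^ (j + 3) * r),
        G t * ENNReal.ofReal (1 / t) := ENNReal.tsum_le_tsum hterm
    _ = 2 * ∫⁻ t in ⋃ j : ℕ, Ioc (2 ^ (j + 2) * r) (2 ^ (j + 3) * r),
        G t * ENNReal.ofReal (1 / t) := by
        rw [ENNReal.tsum_mul_left, lintegral_iUnion (fun j => measurableSet_Ioc) hdisj]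
    _ ≤ _ := by
        refine mul_le_mul_right (lintegral_mono_set (iUnion_subset fun j t ht => ?_)) _
        have : (1 : ℝ) ≤ 2 ^ (j + 2) := one_le_pow₀ one_le_two
        exact lt_of_le_of_lt (by nlinarith) ht.1

lemma eLpNorm_ball_le_morreyNorm_mul {p : ℝ} {φ : Rn n → ℝ → ℝ≥0} {x₀ : Rn n}
    {w : Rn n → ℝ} (hw : IsWeight w) (f : Rn n → 𝕜) (hf : morreyNorm p φ x₀ w f < ∞)
    {r : ℝ} (hr : 0 < r) :
    eLpNorm f (ENNReal.ofReal p) ((wMeasure w).restrict (ball x₀ r)) ≤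
      morreyNorm p φ x₀ w f * (φ x₀ r * wMeasure w (ball x₀ r) ^ (1 / p)) := by
  have h0 := hw.wMeasure_ball_ne_zero x₀ hr
  have ht := (hw.wMeasure_ball_lt_top x₀ r).ne
  set A := wMeasure w (ball x₀ r) with hA
  set L := eLpNorm f (ENNReal.ofReal p) ((wMeasure w).restrict (ball x₀ r)) with hL
  have h1 : (φ x₀ r : ℝ≥0∞)⁻¹ * A ^ (-(1 / p)) * L ≤ morreyNorm p φ x₀ w f :=
    le_iSup₂_of_le (f := fun (r : ℝ) (_ : 0 < r) => (φ x₀ r : ℝ≥0∞)⁻¹ *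
      (wMeasure w (ball x₀ r)) ^ (-(1 / p)) *
      eLpNorm f (ENNReal.ofReal p) ((wMeasure w).restrict (ball x₀ r))) r hr le_rfl
  have hAneg : A ^ (-(1 / p)) ≠ 0 := by
    rw [ENNReal.rpow_neg]
    exact ENNReal.inv_ne_zero.2 (ENNReal.rpow_ne_top_of_ne_zero h0 ht)
  rcases eq_or_ne (φ x₀ r) 0 with hφ | hφ
  · -- here `φ⁻¹ = ∞`, so that finiteness of the norm forces `f` to vanish on the ball
    have hL0 : L = 0 := by
      by_contra hL0
      rw [hφ, ENNReal.coe_zero, ENNReal.inv_zero, ENNReal.top_mul hAneg, ENNReal.top_mul hL0] at h1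
      exact (lt_of_le_of_lt h1 hf).ne rfl
    rw [hL0]
    exact zero_le
  · have hφ0 : (φ x₀ r : ℝ≥0∞) ≠ 0 := by exact_mod_cast hφ
    calc L = ((φ x₀ r : ℝ≥0∞)⁻¹ * φ x₀ r) * (A ^ (1 / p) * A ^ (-(1 / p))) * L := by
          rw [ENNReal.inv_mul_cancel hφ0 ENNReal.coe_ne_top,
            ENNReal.rpow_mul_rpow_neg_eq_one h0 ht, one_mul, one_mul]
      _ = (φ x₀ r : ℝ≥0∞)⁻¹ * A ^ (-(1 / p)) * L * (φ x₀ r * A ^ (1 / p)) := by ring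
      _ ≤ _ := by gcongr

/-- The integral in `logCondition`. -/
noncomputable def logIntegral (P : Fin m → ℝ) (w : Fin m → Rn n → ℝ)
    (φ₁ : Fin m → Rn n → ℝ → ℝ≥0) (x₀ : Rn n) (r : ℝ) : ℝ≥0∞ :=
  ∫⁻ t in Ioi r, ENNReal.ofReal ((1 + Real.log (t / r)) ^ m) *
      (essInf (fun η => ∏ i, (φ₁ i x₀ η : ℝ≥0∞) * (wMeasure (w i) (ball x₀ η)) ^ (1 / P i))
          (volume.restrict (Ioi t)) /
        ∏ i, (wMeasure (w i) (ball x₀ t)) ^ (1 / P i)) *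
      ENNReal.ofReal (1 / t)

/-- The series in the local size condition is dominated by the integral in `logCondition`. -/
lemma exists_tsum_le_logIntegral {P : Fin m → ℝ} {w : Fin m → Rn n → ℝ} (hn : 0 < n)
    (hP : ∀ i, 1 < P i) (hA : ∀ i, IsAInfty (w i)) (φ₁ : Fin m → Rn n → ℝ → ℝ≥0) (x₀ : Rn n)
    (𝕜 : Type*) [RCLike 𝕜] :
    ∃ C : ℝ≥0, ∀ f : Fin m → Rn n → 𝕜,
      (∀ i, morreyNorm (P i) (φ₁ i) x₀ (w i) (f i) < ∞) → ∀ r : ℝ, 0 < r →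
      ∑' j : ℕ, (((j + 2 : ℕ) : ℝ≥0∞) + 1) ^ m * ((∏ i, eLpNorm (f i) (ENNReal.ofReal (P i))
          ((wMeasure (w i)).restrict (ball x₀ (2 ^ (j + 2) * r)))) /
          ∏ i, wMeasure (w i) (ball x₀ (2 ^ (j + 2) * r)) ^ (1 / P i)) ≤
        C * (∏ i, morreyNorm (P i) (φ₁ i) x₀ (w i) (f i)) * logIntegral P w φ₁ x₀ r := by
  have hw := fun i => (hA i).isWeight
  have hP0 : ∀ i, 0 ≤ 1 / P i := fun i => (one_div_pos.2 (one_pos.trans (hP i))).le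
  choose C hC using fun i => (hA i).ballComparable.exists_doubling hn one_le_two
  refine ⟨2 * (2 ^ m * ∏ i, C i ^ (1 / P i)), fun f hf r hr => ?_⟩
  set N := ∏ i, morreyNorm (P i) (φ₁ i) x₀ (w i) (f i) with hN
  have hNt : N ≠ ∞ := ENNReal.prod_ne_top fun i _ => (hf i).ne
  set F : ℝ → ℝ≥0∞ := fun η => ∏ i, (φ₁ i x₀ η : ℝ≥0∞) *
    (wMeasure (w i) (ball x₀ η)) ^ (1 / P i) with hF
  set W : ℝ → ℝ≥0∞ := fun t => ∏ i, (wMeasure (w i) (ball x₀ t)) ^ (1 / P i) with hW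
  set L : ℝ → ℝ≥0∞ := fun R => ∏ i, eLpNorm (f i) (ENNReal.ofReal (P i))
    ((wMeasure (w i)).restrict (ball x₀ R)) with hL
  set K : ℝ≥0 := ∏ i, C i ^ (1 / P i) with hK
  have hKe : (K : ℝ≥0∞) = ∏ i, (C i : ℝ≥0∞) ^ (1 / P i) := by
    rw [hK, ENNReal.ofNNReal_finsetProd]
    exact Finset.prod_congr rfl fun i _ => ENNReal.coe_rpow_of_nonneg _ (hP0 i)
  set G : ℝ → ℝ≥0∞ := fun t => ENNReal.ofReal ((1 + Real.log (t / r)) ^ m) *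
    (essInf F (volume.restrict (Ioi t)) / W t) with hG
  have hLF : ∀ R η, 0 < R → R < η → L R ≤ N * F η := by
    intro R η hR hη
    simp only [hL, hN, hF]
    rw [← Finset.prod_mul_distrib]
    refine Finset.prod_le_prod' fun i _ => ?_
    refine le_trans (eLpNorm_mono_measure _ (Measure.restrict_mono (ball_subset_ball hη.le) le_rfl))
      (eLpNorm_ball_le_morreyNorm_mul (hw i) (f i) (hf i) (hR.trans hη))
  have hLess : ∀ R t, 0 < R → R < t → L R ≤ N * essInf F (volume.restrict (Ioi t)) := by
    intro R t hR ht
    rcases eq_or_ne N 0 with h0 | h0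
    · have := hLF R t hR ht
      rw [h0, zero_mul] at this ⊢
      exact this
    · have h1 : N⁻¹ * L R ≤ essInf F (volume.restrict (Ioi t)) := by
        refine le_essInf_of_ae_le _ ?_
        filter_upwards [ae_restrict_mem measurableSet_Ioi] with η hη
        rw [mul_comm, ← div_eq_mul_inv]
        exact ENNReal.div_le_of_le_mul' (hLF R η hR (ht.trans hη))
      calc L R = N * (N⁻¹ * L R) := by
            rw [← mul_assoc, ENNReal.mul_inv_cancel h0 hNt, one_mul]
        _ ≤ _ := by gcongr
  have hW0 : ∀ t, 0 < t → W t ≠ 0 := fun t ht => Finset.prod_ne_zero_iff.2 fun i _ => by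
    rw [ne_eq, ENNReal.rpow_eq_zero_iff_of_pos (one_div_pos.2 (one_pos.trans (hP i)))]
    exact (hw i).wMeasure_ball_ne_zero x₀ ht
  have hWt : ∀ t, W t ≠ ∞ := fun t => ENNReal.prod_ne_top fun i _ =>
    ENNReal.rpow_ne_top_of_nonneg (hP0 i) ((hw i).wMeasure_ball_lt_top _ _).ne
  have hWdoub : ∀ R t, 0 < R → t ≤ 2 * R → W t ≤ K * W R := by
    intro R t hR ht
    rw [hKe]
    simp only [hW]
    rw [← Finset.prod_mul_distrib]
    refine Finset.prod_le_prod' fun i _ => ?_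
    rw [← ENNReal.mul_rpow_of_nonneg _ _ (hP0 i)]
    exact ENNReal.rpow_le_rpow ((measure_mono (ball_subset_ball ht)).trans (hC i x₀ R hR)) (hP0 i)
  have hterm : ∀ j : ℕ, ∀ t ∈ Ioc (2 ^ (j + 2) * r) (2 ^ (j + 3) * r),
      (((j + 2 : ℕ) : ℝ≥0∞) + 1) ^ m * (L (2 ^ (j + 2) * r) / W (2 ^ (j + 2) * r)) ≤
        (2 ^ m * K * N) * G t := by
    intro j t ht
    have hR : 0 < 2 ^ (j + 2) * r := by positivity
    have ht0 : 0 < t := hR.trans ht.1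
    have hlog : ((j : ℝ) + 2) + 1 ≤ 2 * (1 + Real.log (t / r)) := by
      have h1 : ((j : ℝ) + 2) * Real.log 2 ≤ Real.log (t / r) := by
        have h2 : Real.log ((2 : ℝ) ^ (j + 2)) ≤ Real.log (t / r) := by
          refine Real.log_le_log (by positivity) ?_
          rw [le_div_iff₀ hr]
          exact ht.1.le
        rw [Real.log_pow] at h2
        exact_mod_cast h2
      have h3 := Real.log_two_gt_d9
      have h4 : (0 : ℝ) ≤ j := Nat.cast_nonneg j
      nlinarith
    have h1 : (((j + 2 : ℕ) : ℝ≥0∞) + 1) ^ m ≤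
        2 ^ m * ENNReal.ofReal ((1 + Real.log (t / r)) ^ m) := by
      have hpos : 0 ≤ 1 + Real.log (t / r) := by
        have h4 : (0 : ℝ) ≤ j := Nat.cast_nonneg j
        linarith
      have h5 : (((j + 2 : ℕ) : ℝ≥0∞) + 1) = ENNReal.ofReal (((j : ℝ) + 2) + 1) := by
        rw [show ((j : ℝ) + 2) + 1 = ((j + 2 + 1 : ℕ) : ℝ) by push_cast; ring,
          ENNReal.ofReal_natCast]
        push_cast; ring
      rw [h5, ENNReal.ofReal_pow hpos, ← mul_pow]
      refine pow_le_pow_left' ?_ m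
      rw [show (2 : ℝ≥0∞) = ENNReal.ofReal 2 by simp, ← ENNReal.ofReal_mul zero_le_two]
      exact ENNReal.ofReal_le_ofReal hlog
    have h2 : (W (2 ^ (j + 2) * r))⁻¹ ≤ K * (W t)⁻¹ := by
      have := hWdoub _ t hR (by rw [show 2 * (2 ^ (j + 2) * r) = 2 ^ (j + 3) * r by
        rw [pow_succ _ (j + 2)]; ring]; exact ht.2)
      rw [← div_eq_mul_inv, ENNReal.le_div_iff_mul_le (Or.inl (hW0 t ht0)) (Or.inl (hWt t)),
        mul_comm, ← div_eq_mul_inv]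
      exact ENNReal.div_le_of_le_mul this
    calc _ ≤ (2 ^ m * ENNReal.ofReal ((1 + Real.log (t / r)) ^ m)) *
          ((N * essInf F (volume.restrict (Ioi t))) * (K * (W t)⁻¹)) := by
          rw [div_eq_mul_inv]
          exact mul_le_mul' h1 (mul_le_mul' (hLess _ t hR ht.1) h2)
      _ = _ := by rw [hG]; simp only [div_eq_mul_inv]; ring
  refine (tsum_le_lintegral_Ioi hr _ _ hterm).trans_eq ?_
  have hct : 2 ^ m * (K : ℝ≥0∞) * N ≠ ∞ :=
    ENNReal.mul_ne_top (ENNReal.mul_ne_top (by finiteness) ENNReal.coe_ne_top) hNt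
  simp only [mul_assoc (2 ^ m * (K : ℝ≥0∞) * N)]
  rw [lintegral_const_mul' _ _ hct, logIntegral]
  push_cast
  ring

/-- The commutator is bounded, with a constant that depends linearly on the constants of the local
conditions. -/
lemma exists_boundedBy_iteratedCommutator (hn : 0 < n) (hm : 0 < m)
    {p : ℝ} {P : Fin m → ℝ} (hP : ∀ i, 1 < P i) (hp : 1 / p = ∑ i, 1 / P i)
    {w : Fin m → Rn n → ℝ} (hwP : IsMultiAP p P w) (hw : ∀ i, IsAInfty (w i))
    {v : Rn n → ℝ} (hv : IsAInfty v) {x₀ : Rn n}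
    {φ₁ : Fin m → Rn n → ℝ → ℝ≥0} {φ₂ : Rn n → ℝ → ℝ≥0}
    (hφ : logCondition P w φ₁ φ₂ x₀ < ∞) (𝕜 : Type*) [RCLike 𝕜] :
    ∃ C : ℝ≥0, ∀ (T : (Fin m → Rn n → 𝕜) → Rn n → 𝕜) (b : Fin m → Rn n → 𝕜) (A₁ : ℝ≥0)
      (A₂ : ℝ≥0∞), A₂ ≠ ∞ → (∀ i, IsBMO (b i)) →
      IsMSublinear T
        (fun i => commDomain (b i) (normSpace (morreyNorm (P i) (φ₁ i) x₀ (w i)))) →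
      LocalSize T
        (fun i => commDomain (b i) (normSpace (morreyNorm (P i) (φ₁ i) x₀ (w i)))) A₁ →
      LocalBound (iteratedCommutator T b)
        (fun i => morreyNorm (P i) (φ₁ i) x₀ (w i)) (morreyNorm p φ₂ x₀ v) A₂ →
      BoundedBy (iteratedCommutator T b)
        (fun i => morreyNorm (P i) (φ₁ i) x₀ (w i)) (morreyNorm p φ₂ x₀ v)
        (C * (A₂ + A₁ * ∏ i, bmoNorm (b i))) := by
  have hp0 := pos_of_one_div_eq_sum hm hP hp
  have hp0' : 0 < 1 / p := one_div_pos.2 hp0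
  obtain ⟨C₁, hC₁⟩ := hwP.exists_prod_ballMean_commTuple_le hn hm hP hp hw 𝕜
  obtain ⟨C₂, hC₂⟩ := exists_tsum_le_logIntegral hn hP hw φ₁ x₀ 𝕜
  obtain ⟨C₃, hC₃⟩ := hv.ballComparable.exists_lintegral_prod_rpow_le hn hm hp0 𝕜
  set Λ := logCondition P w φ₁ φ₂ x₀ with hΛ
  set 𝒦 : Finset (Finset (Fin m) × Finset (Fin m)) :=
    ((Finset.univ : Finset (Finset (Fin m))).erase ∅) ×ˢ Finset.univ with h𝒦
  -- the constants from the quasi-triangle inequality in `L ^ p`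
  set D : ℝ≥0∞ := 2 * 2 ^ (1 / p) with hD
  set E : ℝ≥0∞ := ((𝒦.card : ℝ≥0∞) ^ p * 𝒦.card) ^ (1 / p) with hE
  have hDt : D ≠ ∞ := ENNReal.mul_ne_top ENNReal.ofNat_ne_top
    (ENNReal.rpow_ne_top_of_nonneg hp0'.le ENNReal.ofNat_ne_top)
  have hEt : E ≠ ∞ := ENNReal.rpow_ne_top_of_nonneg hp0'.le
    (ENNReal.mul_ne_top (ENNReal.rpow_ne_top_of_nonneg hp0.le (ENNReal.natCast_ne_top _))
      (ENNReal.natCast_ne_top _))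
  set C : ℝ≥0∞ := D * (1 + E * (C₁ * C₂ * C₃) * Λ) with hC
  have hCt : C ≠ ∞ := ENNReal.mul_ne_top hDt (ENNReal.add_ne_top.2 ⟨ENNReal.one_ne_top,
    ENNReal.mul_ne_top (ENNReal.mul_ne_top hEt (by finiteness)) hφ.ne⟩)
  refine ⟨C.toNNReal, fun T b A₁ A₂ hA₂ hb hT hLS hLB f hf => ?_⟩
  rw [ENNReal.coe_toNNReal hCt]
  set N := ∏ i, morreyNorm (P i) (φ₁ i) x₀ (w i) (f i) with hN
  have hNt : N ≠ ∞ := ENNReal.prod_ne_top fun i _ => (hf i).2.ne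
  set β := ∏ i, bmoNorm (b i) with hβ
  have hβt : β ≠ ∞ := ENNReal.prod_ne_top fun i _ => (hb i).2.ne
  have hX := fun i => isTruncClosed_normSpace_morreyNorm (𝕜 := 𝕜) (P i) (φ₁ i) x₀ (w i)
  have hmeas := hLB.1 f hf
  have hvac := hv.ballComparable.ac
  suffices hmain : morreyNorm p φ₂ x₀ v (iteratedCommutator T b f) ≤ C * (A₂ + A₁ * β) * N from
    ⟨⟨hmeas, hmain.trans_lt (ENNReal.mul_lt_top (ENNReal.mul_lt_top hCt.lt_top
      (ENNReal.add_lt_top.2 ⟨hA₂.lt_top, ENNReal.mul_lt_top ENNReal.coe_lt_top hβt.lt_top⟩))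
      hNt.lt_top)⟩, hmain⟩
  refine iSup₂_le fun r hr => ?_
  set I := logIntegral P w φ₁ x₀ r with hI
  set B := ball x₀ r with hB
  set l : Fin m → 𝕜 := fun i => ⨍ y in ballCube x₀ r, b i y with hl
  set ν := wMeasure v with hν
  set U := iteratedCommutator T b (truncTuple ∅ x₀ r f) with hU
  set g : Finset (Fin m) → Finset (Fin m) → Fin m → Rn n → 𝕜 := fun S Q =>
    truncTuple S x₀ r (commTuple b l Q f) with hg
  set β₁ : Finset (Fin m) → ℝ≥0∞ := fun Q => ∏ i, if i ∈ Q then 1 else bmoNorm (b i) with hβ₁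
  set β₂ : Finset (Fin m) → ℝ≥0∞ := fun Q => ∏ i, if i ∈ Q then bmoNorm (b i) else 1 with hβ₂
  have hββ : ∀ Q, β₁ Q * β₂ Q = β := by
    intro Q
    simp only [hβ₁, hβ₂, hβ]
    rw [← Finset.prod_mul_distrib]
    refine Finset.prod_congr rfl fun i _ => ?_
    split_ifs <;> simp
  set Z : Finset (Fin m) → ℝ≥0∞ := fun Q => A₁ * (C₁ * β₁ Q * (C₂ * N * I)) with hZ
  have hTae : ∀ κ ∈ 𝒦, ∀ᵐ x ∂(volume.restrict B), ‖T (g κ.1 κ.2) x‖ₑ ≤ Z κ.2 := by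
    rintro ⟨S, Q⟩ hκ
    have hS : S.Nonempty := by
      rw [h𝒦, Finset.mem_product] at hκ
      exact Finset.nonempty_iff_ne_empty.2 (Finset.ne_of_mem_erase hκ.1)
    have h1 := hLS x₀ r hr (commTuple b l Q f) (commTuple_mem hX hf l Q) S hS
    have h2 : ∑' j : ℕ, ∏ i, ballMean x₀ (2 ^ (j + 2) * r) (fun y => ‖commTuple b l Q f i y‖ₑ) ≤
        C₁ * β₁ Q * (C₂ * N * I) := by
      refine (ENNReal.tsum_le_tsum fun j =>
        hC₁ b f hb (fun i => (hf i).1) x₀ r hr (j + 2) Q).trans ?_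
      rw [ENNReal.tsum_mul_left]
      exact mul_le_mul_right (hC₂ f (fun i => (hf i).2) r hr) _
    rw [eLpNorm_exponent_top] at h1
    filter_upwards [ae_le_eLpNormEssSup (f := T (g S Q)) (μ := volume.restrict B)] with x hx
    exact hx.trans (h1.trans (mul_le_mul_right h2 _))
  set H : Finset (Fin m) × Finset (Fin m) → Rn n → ℝ≥0∞ := fun κ x =>
    (∏ i ∈ κ.2, ‖b i x - l i‖ₑ) * Z κ.2 with hH
  have hbm : ∀ i, AEMeasurable (fun x => ‖b i x - l i‖ₑ) ν := fun i =>
    (((hb i).1.aestronglyMeasurable.mono_ac hvac).sub aestronglyMeasurable_const).enorm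
  have hprodm : ∀ Q : Finset (Fin m), AEMeasurable (fun x => ∏ i ∈ Q, ‖b i x - l i‖ₑ) ν :=
    fun Q => Finset.aemeasurable_fun_prod _ fun i _ => hbm i
  have hHm : ∀ κ, AEMeasurable (H κ) ν := fun κ => (hprodm κ.2).mul_const _
  have hpt : ∀ᵐ x ∂(ν.restrict B), ‖iteratedCommutator T b f x‖ₑ ≤ ‖U x‖ₑ + ∑ κ ∈ 𝒦, H κ x := by
    have h1 : ∀ᵐ x ∂(ν.restrict B), ∀ κ ∈ 𝒦, ‖T (g κ.1 κ.2) x‖ₑ ≤ Z κ.2 :=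
      (hvac.restrict B).ae_le ((Filter.eventually_all_finset 𝒦).2 hTae)
    filter_upwards [h1] with x hx
    have h2 := hT.norm_iteratedCommutator_le hX hf l x₀ r x
    rw [← Finset.sum_product'] at h2
    have h3 : ‖iteratedCommutator T b f x‖ₑ ≤ ‖U x‖ₑ + ∑ κ ∈ 𝒦,
        (∏ i ∈ κ.2, ‖b i x - l i‖ₑ) * ‖T (g κ.1 κ.2) x‖ₑ := by
      have h4 := ENNReal.ofReal_le_ofReal h2
      rw [ENNReal.ofReal_add (norm_nonneg _) (Finset.sum_nonneg fun κ _ => by positivity),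
        ENNReal.ofReal_sum_of_nonneg (fun κ _ => by positivity)] at h4
      simp only [ENNReal.ofReal_mul (Finset.prod_nonneg fun i _ => norm_nonneg _),
        ENNReal.ofReal_prod_of_nonneg (fun i _ => norm_nonneg _), ofReal_norm] at h4
      exact h4
    refine h3.trans ?_
    gcongr with κ hκ
    exact mul_le_mul_right (hx κ hκ) _
  set Y : ℝ≥0∞ := C₁ * C₂ * C₃ * I * (A₁ * β) * N with hY
  have hHint : ∀ κ, ∫⁻ x in B, H κ x ^ p ∂ν ≤ Y ^ p * ν B := by
    intro κ
    calc ∫⁻ x in B, H κ x ^ p ∂ν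
        = ∫⁻ x in B, (∏ i ∈ κ.2, ‖b i x - l i‖ₑ) ^ p * Z κ.2 ^ p ∂ν := by
          simp only [hH, ENNReal.mul_rpow_of_nonneg _ _ hp0.le]
      _ = (∫⁻ x in B, (∏ i ∈ κ.2, ‖b i x - l i‖ₑ) ^ p ∂ν) * Z κ.2 ^ p :=
          lintegral_mul_const'' _ ((hprodm κ.2).pow_const _).restrict
      _ ≤ (C₃ * β₂ κ.2) ^ p * ν B * Z κ.2 ^ p := by
          gcongr
          exact hC₃ b hb x₀ r hr κ.2
      _ = ((C₃ * β₂ κ.2) * Z κ.2) ^ p * ν B := by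
          rw [ENNReal.mul_rpow_of_nonneg _ (Z κ.2) hp0.le]; ring
      _ = Y ^ p * ν B := by
          congr 2
          rw [hY, hZ, ← hββ κ.2]
          ring
  have hsum : ∫⁻ x in B, (∑ κ ∈ 𝒦, H κ x) ^ p ∂ν ≤ (𝒦.card : ℝ≥0∞) ^ p * 𝒦.card * (Y ^ p * ν B) := by
    calc _ ≤ ∫⁻ x in B, (𝒦.card : ℝ≥0∞) ^ p * ∑ κ ∈ 𝒦, H κ x ^ p ∂ν :=
          lintegral_mono fun x => sum_rpow_le 𝒦 (fun κ => H κ x) hp0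
      _ = (𝒦.card : ℝ≥0∞) ^ p * ∑ κ ∈ 𝒦, ∫⁻ x in B, H κ x ^ p ∂ν := by
          rw [lintegral_const_mul' _ _ (ENNReal.rpow_ne_top_of_nonneg hp0.le
            (ENNReal.natCast_ne_top _)), lintegral_finsetSum' _ fun κ _ =>
              ((hHm κ).pow_const _).restrict]
      _ ≤ (𝒦.card : ℝ≥0∞) ^ p * ∑ _κ ∈ 𝒦, (Y ^ p * ν B) := by
          gcongr with κ
          exact hHint κ
      _ = _ := by rw [Finset.sum_const, nsmul_eq_mul]; ring
  have heLp : ∀ h : Rn n → 𝕜, eLpNorm h (ENNReal.ofReal p) (ν.restrict B) =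
      (∫⁻ x in B, ‖h x‖ₑ ^ p ∂ν) ^ (1 / p) := fun h => by
    rw [eLpNorm_eq_lintegral_rpow_enorm_toReal (by simpa using hp0) ENNReal.ofReal_ne_top,
      ENNReal.toReal_ofReal hp0.le]
  have hnorm : eLpNorm (iteratedCommutator T b f) (ENNReal.ofReal p) (ν.restrict B) ≤
      D * (eLpNorm U (ENNReal.ofReal p) (ν.restrict B) + E * Y * ν B ^ (1 / p)) := by
    have h1 : ∫⁻ x in B, ‖iteratedCommutator T b f x‖ₑ ^ p ∂ν ≤
        2 ^ p * ((∫⁻ x in B, ‖U x‖ₑ ^ p ∂ν) +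
          (𝒦.card : ℝ≥0∞) ^ p * 𝒦.card * (Y ^ p * ν B)) := by
      calc _ ≤ ∫⁻ x in B, 2 ^ p * (‖U x‖ₑ ^ p + (∑ κ ∈ 𝒦, H κ x) ^ p) ∂ν := by
            refine lintegral_mono_ae ?_
            filter_upwards [hpt] with x hx
            exact (ENNReal.rpow_le_rpow hx hp0.le).trans (add_rpow_le _ _ hp0)
        _ = 2 ^ p * ((∫⁻ x in B, ‖U x‖ₑ ^ p ∂ν) + ∫⁻ x in B, (∑ κ ∈ 𝒦, H κ x) ^ p ∂ν) := by
            rw [lintegral_const_mul' _ _ (ENNReal.rpow_ne_top_of_nonneg hp0.le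
              ENNReal.ofNat_ne_top), lintegral_add_right']
            exact ((Finset.aemeasurable_fun_sum _ fun κ _ => hHm κ).pow_const _).restrict
        _ ≤ _ := by gcongr
    rw [heLp, heLp]
    calc _ ≤ _ := ENNReal.rpow_le_rpow h1 hp0'.le
      _ ≤ 2 * (2 ^ (1 / p) * ((∫⁻ x in B, ‖U x‖ₑ ^ p ∂ν) ^ (1 / p) +
          ((𝒦.card : ℝ≥0∞) ^ p * 𝒦.card * (Y ^ p * ν B)) ^ (1 / p))) := by
          rw [ENNReal.mul_rpow_of_nonneg _ _ hp0'.le, ← ENNReal.rpow_mul,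
            mul_one_div_cancel hp0.ne', ENNReal.rpow_one]
          gcongr
          exact add_rpow_le _ _ hp0'
      _ = _ := by
          rw [ENNReal.mul_rpow_of_nonneg _ (Y ^ p * ν B) hp0'.le,
            ENNReal.mul_rpow_of_nonneg (Y ^ p) _ hp0'.le, ← ENNReal.rpow_mul,
            mul_one_div_cancel hp0.ne', ENNReal.rpow_one]
          ring
  have hUle : (φ₂ x₀ r : ℝ≥0∞)⁻¹ * ν B ^ (-(1 / p)) *
      eLpNorm U (ENNReal.ofReal p) (ν.restrict B) ≤ A₂ * N :=
    le_trans (le_iSup₂_of_le (f := fun (r : ℝ) (_ : 0 < r) => (φ₂ x₀ r : ℝ≥0∞)⁻¹ *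
      (wMeasure v (ball x₀ r)) ^ (-(1 / p)) *
      eLpNorm U (ENNReal.ofReal p) ((wMeasure v).restrict (ball x₀ r))) r hr le_rfl)
      (hLB.2 x₀ r hr f hf)
  have hIle : (φ₂ x₀ r : ℝ≥0∞)⁻¹ * I ≤ Λ :=
    le_iSup₂_of_le (f := fun (r : ℝ) (_ : 0 < r) => (φ₂ x₀ r : ℝ≥0∞)⁻¹ *
      logIntegral P w φ₁ x₀ r) r hr le_rfl
  have hνB : ν B ^ (1 / p) * ν B ^ (-(1 / p)) = 1 :=
    ENNReal.rpow_mul_rpow_neg_eq_one (hv.isWeight.wMeasure_ball_ne_zero x₀ hr)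
      (hv.isWeight.wMeasure_ball_lt_top x₀ r).ne _
  calc _ ≤ (φ₂ x₀ r : ℝ≥0∞)⁻¹ * ν B ^ (-(1 / p)) *
        (D * (eLpNorm U (ENNReal.ofReal p) (ν.restrict B) + E * Y * ν B ^ (1 / p))) := by gcongr
    _ = D * ((φ₂ x₀ r : ℝ≥0∞)⁻¹ * ν B ^ (-(1 / p)) * eLpNorm U (ENNReal.ofReal p) (ν.restrict B) +
        E * (C₁ * C₂ * C₃) * ((φ₂ x₀ r : ℝ≥0∞)⁻¹ * I) * (A₁ * β) * N *
          (ν B ^ (1 / p) * ν B ^ (-(1 / p)))) := by rw [hY]; ring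
    _ ≤ D * (A₂ * N + E * (C₁ * C₂ * C₃) * Λ * (A₁ * β) * N) := by
        rw [hνB, mul_one]
        gcongr
    -- the added terms complete the product `(1 + E * (C₁ * C₂ * C₃) * Λ) * (A₂ + A₁ * β)`
    _ ≤ D * (A₂ * N + E * (C₁ * C₂ * C₃) * Λ * (A₁ * β) * N) +
        D * (E * (C₁ * C₂ * C₃) * Λ * A₂ * N + A₁ * β * N) := le_self_add
    _ = _ := by rw [hC]; ring

end Commutator

theorem theorem1p4 {𝕜 : Type*} [RCLike 𝕜] (n m : ℕ) (hn : 0 < n) (hm : 0 < m)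
    (p : ℝ) (P : Fin m → ℝ) (hP : ∀ i, 1 < P i) (hp : 1 / p = ∑ i, 1 / P i)
    (w : Fin m → Rn n → ℝ) (hwP : IsMultiAP p P w) (hw : ∀ i, IsAInfty (w i))
    (v : Rn n → ℝ) (hv : IsAInfty v) (x₀ : Rn n)
    (φ₁ : Fin m → Rn n → ℝ → ℝ≥0) (φ₂ : Rn n → ℝ → ℝ≥0)
    (hφ₁ : ∀ i, Measurable (fun z : Rn n × Ioi (0 : ℝ) => φ₁ i z.1 z.2))
    (hφ₂ : Measurable (fun z : Rn n × Ioi (0 : ℝ) => φ₂ z.1 z.2))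
    (hφ : logCondition P w φ₁ φ₂ x₀ < ∞) :
    -- boundedness of the iterated commutator
    (∀ (T : (Fin m → Rn n → 𝕜) → Rn n → 𝕜) (b : Fin m → Rn n → 𝕜),
      (∀ i, IsBMO (b i)) →
      IsMSublinear T
        (fun i => commDomain (b i) (normSpace (morreyNorm (P i) (φ₁ i) x₀ (w i)))) →
      (∃ A : ℝ≥0, LocalSize T
        (fun i => commDomain (b i) (normSpace (morreyNorm (P i) (φ₁ i) x₀ (w i)))) A) →
      (∃ A : ℝ≥0, LocalBound (iteratedCommutator T b)
        (fun i => morreyNorm (P i) (φ₁ i) x₀ (w i)) (morreyNorm p φ₂ x₀ v) A) →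
      ∃ K : ℝ≥0, BoundedBy (iteratedCommutator T b)
        (fun i => morreyNorm (P i) (φ₁ i) x₀ (w i)) (morreyNorm p φ₂ x₀ v) K) ∧
    -- the norm estimate, with a constant that does not depend on `T` and `b`
    (∀ A₁ A₂ : ℝ≥0, ∃ K : ℝ≥0,
      ∀ (T : (Fin m → Rn n → 𝕜) → Rn n → 𝕜) (b : Fin m → Rn n → 𝕜),
      (∀ i, IsBMO (b i)) →
      IsMSublinear T
        (fun i => commDomain (b i) (normSpace (morreyNorm (P i) (φ₁ i) x₀ (w i)))) →
      LocalSize T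
        (fun i => commDomain (b i) (normSpace (morreyNorm (P i) (φ₁ i) x₀ (w i)))) A₁ →
      LocalBound (iteratedCommutator T b)
        (fun i => morreyNorm (P i) (φ₁ i) x₀ (w i)) (morreyNorm p φ₂ x₀ v)
        (A₂ * ∏ i, bmoNorm (b i)) →
      BoundedBy (iteratedCommutator T b)
        (fun i => morreyNorm (P i) (φ₁ i) x₀ (w i)) (morreyNorm p φ₂ x₀ v)
        (K * ∏ i, bmoNorm (b i))) := by
  obtain ⟨C, hC⟩ := exists_boundedBy_iteratedCommutator hn hm hP hp hwP hw hv hφ 𝕜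
  refine ⟨fun T b hb hT ⟨A₁, hA₁⟩ ⟨A₂, hA₂⟩ => ?_, fun A₁ A₂ => ⟨C * (A₂ + A₁), ?_⟩⟩
  · have hβ : ∏ i, bmoNorm (b i) ≠ ∞ := ENNReal.prod_ne_top fun i _ => (hb i).2.ne
    have hK : C * ((A₂ : ℝ≥0∞) + A₁ * ∏ i, bmoNorm (b i)) ≠ ∞ := by finiteness
    refine ⟨(C * ((A₂ : ℝ≥0∞) + A₁ * ∏ i, bmoNorm (b i))).toNNReal, ?_⟩
    rw [ENNReal.coe_toNNReal hK]
    exact hC T b A₁ A₂ ENNReal.coe_ne_top hb hT hA₁ hA₂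
  · intro T b hb hT hA₁ hA₂
    have hβ : ∏ i, bmoNorm (b i) ≠ ∞ := ENNReal.prod_ne_top fun i _ => (hb i).2.ne
    have h := hC T b A₁ (A₂ * ∏ i, bmoNorm (b i)) (by finiteness) hb hT hA₁ hA₂
    rwa [← add_mul, ← mul_assoc] at h
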